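/- Let $X$ be a compact connected Riemann surface with an anti-holomorphic involution $\sigma : X \to X$. For a holomorphic vector bundle $E \to X$, a real (respectively quaternionic) structure on $E$ is an anti-holomorphic map $\widehat\sigma : E \to E$ of total spaces that covers $\sigma$, is $\mathbb{C}$-antilinear on the fibres, and satisfies $\widehat\sigma^2 = \mathrm{Id}_E$ (respectively $\widehat\sigma^2 = -\mathrm{Id}_E$). If $h$ is a smooth hermitian metric on $E$, the pair $(E,h)$ is called flat if its Chern connection has curvature zero, and $\widehat\sigma$ is called unitary with respect to $h$ if $h(\widehat\sigma v, \widehat\sigma w) = \overline{h(v,w)}$ for all $v, w$ in the same fibre. Proposition. Consider two triples $(E,h,\widehat\sigma)$ and $(E',h',\widehat\sigma')$, where - $(E,h)$ and $(E',h')$ are flat hermitian holomorphic vector bundles over $X$ of rank $n$, - $\widehat\sigma$ and $\widehat\sigma'$ are either both real structures or both quaternionic structures on $E$ and $E'$, and - $\widehat\sigma$ and $\widehat\sigma'$ are unitary with respect to $h$ and $h'$ respectively. Assume that the holomorphic vector bundles $E$ and $E'$ are isomorphic. Then there is a holomorphic isomorphism $f : E \to E'$ (covering the identity of $X$) that transports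 $h$ to $h'$ and $\widehat\sigma$ to $\widehat\sigma'$, that is, $h'(f(v), f(w)) = h(v,w)$ for all $v,w$ in the same fibre of $E$, and $f \circ \widehat\sigma = \widehat\sigma' \circ f$. -/

import Mathlib

open Bundle
open scoped Manifold ContDiff

noncomputable section

namespace RealCurve

section Antiholomorphic

variable {V : Type*} [NormedAddCommGroup V] [NormedSpace ℂ V]
  {H : Type*} [TopologicalSpace H] (I : ModelWithCorners ℂ V H)
  {M : Type*} [TopologicalSpace M] [ChartedSpace H M]
  {V' : Type*} [NormedAddCommGroup V'] [NormedSpace ℂ V']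
  {H' : Type*} [TopologicalSpace H'] (I' : ModelWithCorners ℂ V' H')
  {M' : Type*} [TopologicalSpace M'] [ChartedSpace H' M']

/-- A map between complex manifolds is antiholomorphic if it is continuous and, read in charts,
it is real differentiable at every point with a `ℂ`-antilinear differential. -/
def IsAntiholomorphic (f : M → M') : Prop :=
  Continuous f ∧ ∀ x : M, ∃ L : V →L[ℝ] V',
    (∀ v : V, L (Complex.I • v) = -(Complex.I • L v)) ∧
    HasFDerivWithinAt (writtenInExtChartAt I I' x f) L (Set.range I) (extChartAt I x x)

end Antiholomorphic

/-- The Wirtinger derivative `∂f/∂z = (∂f/∂x - i ∂f/∂y) / 2`. -/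
def dz (f : ℂ → ℂ) (z : ℂ) : ℂ :=
  (1 / 2 : ℂ) * (fderiv ℝ f z 1 - Complex.I * fderiv ℝ f z Complex.I)

/-- The Wirtinger derivative `∂f/∂z̄ = (∂f/∂x + i ∂f/∂y) / 2`. -/
def dzbar (f : ℂ → ℂ) (z : ℂ) : ℂ :=
  (1 / 2 : ℂ) * (fderiv ℝ f z 1 + Complex.I * fderiv ℝ f z Complex.I)

/-- An antiholomorphic involution of a one-dimensional complex manifold. -/
structure IsAntiholomorphicInvolution {X : Type*} [TopologicalSpace X] [ChartedSpace ℂ X]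
    (σ : X → X) : Prop where
  antiholomorphic : IsAntiholomorphic 𝓘(ℂ, ℂ) 𝓘(ℂ, ℂ) σ
  involutive : Function.Involutive σ

section Bundles

variable {X : Type*} [TopologicalSpace X] [ChartedSpace ℂ X] (n : ℕ)
  (E : X → Type*) [∀ x, TopologicalSpace (E x)] [∀ x, AddCommGroup (E x)] [∀ x, Module ℂ (E x)]
  [TopologicalSpace (TotalSpace (Fin n → ℂ) E)] [FiberBundle (Fin n → ℂ) E]
  (E' : X → Type*) [∀ x, TopologicalSpace (E' x)] [∀ x, AddCommGroup (E' x)]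
  [∀ x, Module ℂ (E' x)]
  [TopologicalSpace (TotalSpace (Fin n → ℂ) E')] [FiberBundle (Fin n → ℂ) E']

/-- A holomorphic isomorphism between two vector bundles of rank `n`, covering the identity. -/
structure HolomorphicIso where
  toEquiv : ∀ x, E x ≃ₗ[ℂ] E' x
  holomorphic : MDifferentiable (𝓘(ℂ, ℂ).prod 𝓘(ℂ, Fin n → ℂ)) (𝓘(ℂ, ℂ).prod 𝓘(ℂ, Fin n → ℂ))
    (fun p : TotalSpace (Fin n → ℂ) E =>
      (⟨p.1, toEquiv p.1 p.2⟩ : TotalSpace (Fin n → ℂ) E'))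
  holomorphic_symm :
    MDifferentiable (𝓘(ℂ, ℂ).prod 𝓘(ℂ, Fin n → ℂ)) (𝓘(ℂ, ℂ).prod 𝓘(ℂ, Fin n → ℂ))
    (fun p : TotalSpace (Fin n → ℂ) E' =>
      (⟨p.1, (toEquiv p.1).symm p.2⟩ : TotalSpace (Fin n → ℂ) E))

/-- The open set, in the coordinate of the preferred chart at `x₀`, over which the preferred
chart at `x₀` and the preferred holomorphic trivialization at `x₀` are both defined. -/
def coordDomain (x₀ : X) : Set ℂ :=
  {z | z ∈ (chartAt ℂ x₀).target ∧
    (chartAt ℂ x₀).symm z ∈ (trivializationAt (Fin n → ℂ) E x₀).baseSet}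

/-- The holomorphic frame `e₁, …, eₙ` of `E` near `x₀` defined by the preferred trivialization,
as a function of the coordinate `z` of the preferred chart. -/
def localFrame (x₀ : X) (i : Fin n) (z : ℂ) : E ((chartAt ℂ x₀).symm z) :=
  (trivializationAt (Fin n → ℂ) E x₀).symm ((chartAt ℂ x₀).symm z) (Pi.single i 1)

/-- A smooth hermitian metric: a smoothly varying positive definite hermitian form on the fibres,
conjugate-linear in the first variable and linear in the second. -/
structure HermitianMetric where
  form : ∀ x, E x →ₗ⋆[ℂ] E x →ₗ[ℂ] ℂ
  conj_symm : ∀ x (v w : E x), starRingEnd ℂ (form x v w) = form x w v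
  pos : ∀ x (v : E x), v ≠ 0 → 0 < (form x v v).re
  smooth : ∀ (x₀ : X) (i j : Fin n), ContDiffOn ℝ ∞
    (fun z => form ((chartAt ℂ x₀).symm z) (localFrame n E x₀ i z) (localFrame n E x₀ j z))
    (coordDomain n E x₀)

/-- A lift of `σ` to `E`: an antiholomorphic map of the total space over `σ` that is antilinear
on the fibres. (Real and quaternionic structures, the lifts whose square is `1` or `-1`, are
automatically isomorphisms.) -/
structure Lift (σ : X → X) where
  toFun : ∀ x, E x →ₗ⋆[ℂ] E (σ x)
  antiholomorphic :
    IsAntiholomorphic (𝓘(ℂ, ℂ).prod 𝓘(ℂ, Fin n → ℂ)) (𝓘(ℂ, ℂ).prod 𝓘(ℂ, Fin n → ℂ))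
      (fun p : TotalSpace (Fin n → ℂ) E =>
        (⟨σ p.1, toFun p.1 p.2⟩ : TotalSpace (Fin n → ℂ) E))

variable {n E}

namespace HermitianMetric

/-- The Gram matrix `H = (h(eᵢ, eⱼ))` of the metric in the local holomorphic frame at `x₀`. -/
def gram (h : HermitianMetric n E) (x₀ : X) (z : ℂ) : Matrix (Fin n) (Fin n) ℂ :=
  Matrix.of fun i j =>
    h.form ((chartAt ℂ x₀).symm z) (localFrame n E x₀ i z) (localFrame n E x₀ j z)

/-- The coefficient `A = H⁻¹ ∂H/∂z` of the connection form `A dz` of the Chern connection of `h`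
in the local holomorphic frame at `x₀`. -/
def chernForm (h : HermitianMetric n E) (x₀ : X) (z : ℂ) : Matrix (Fin n) (Fin n) ℂ :=
  (h.gram x₀ z)⁻¹ * Matrix.of fun i j => dz (fun w => h.gram x₀ w i j) z

/-- The curvature of the Chern connection of `h` is `∂̄(A dz) = curvature · dz̄ ∧ dz`
in the local holomorphic frame at `x₀`. -/
def curvature (h : HermitianMetric n E) (x₀ : X) (z : ℂ) : Matrix (Fin n) (Fin n) ℂ :=
  Matrix.of fun i j => dzbar (fun w => h.chernForm x₀ w i j) z

/-- The hermitian holomorphic bundle `(E, h)` is flat: its Chern connection has curvature zero. -/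
def IsFlat (h : HermitianMetric n E) : Prop :=
  ∀ x₀ : X, ∀ z ∈ coordDomain n E x₀, h.curvature x₀ z = 0

end HermitianMetric

namespace Lift

variable {σ : X → X}

/-- The map of total spaces defined by a lift. -/
def totalMap (s : Lift n E σ) (p : TotalSpace (Fin n → ℂ) E) : TotalSpace (Fin n → ℂ) E :=
  ⟨σ p.1, s.toFun p.1 p.2⟩

/-- A lift is a real structure if its square is the identity of `E`. -/
def IsReal (s : Lift n E σ) : Prop :=
  ∀ p : TotalSpace (Fin n → ℂ) E, s.totalMap (s.totalMap p) = p

/-- A lift is a quaternionic structure if its square is minus the identity of `E`. -/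
def IsQuaternionic (s : Lift n E σ) : Prop :=
  ∀ p : TotalSpace (Fin n → ℂ) E, s.totalMap (s.totalMap p) = ⟨p.1, -p.2⟩

/-- The antilinear lift is unitary (that is, antiunitary on the fibres) with respect to `h`. -/
def IsUnitary (s : Lift n E σ) (h : HermitianMetric n E) : Prop :=
  ∀ x (v w : E x), h.form (σ x) (s.toFun x v) (s.toFun x w) = starRingEnd ℂ (h.form x v w)

end Lift

end Bundles

end RealCurve

end

/-! The isomorphism is first made equivariant, then replaced by the unitary factor of its polar
decomposition; compactness makes both corrections holomorphic.

Equivariance (`exists_equivariant_family`). For a holomorphic isomorphism `φ`, the conjugate `φ' =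
σ̂'⁻¹ φ σ̂` is again holomorphic, and conjugation is an involution because both structures square to
the same sign. Hence `a φ + ā φ'` is equivariant for every complex `a`. With `|a| = 1` it is
invertible as soon as `-a²` is not an eigenvalue of `φ⁻¹ φ'`. The characteristic polynomial of this
endomorphism is constant on `X` (`det_smul_sub_eq`), so only finitely many values have to be
avoided.

Unitarity. Let `ψ` be the equivariant isomorphism and `P = ψ* ψ`. Flatness gives local holomorphic
unitary frames (`exists_holomorphic_factorization`), in which `ψ` is a holomorphic matrix `N` and
`tr P = ‖N‖²`, the Hilbert-Schmidt norm. This global function attains its maximum, so the maximum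
principle makes every `N` locally constant and `P` holomorphic
(`isHolomorphicFamily_adjoint_comp_self`). The eigenvalues of `P` are then the same positive numbers
in all fibres, and one real polynomial `q` satisfies `q(P) = P^(-1/2)` everywhere. The required map
is `ψ q(P)`: it is holomorphic, it is unitary since `q(P) P q(P) = 1`, and it is equivariant since
`q` has real coefficients and `P` commutes with `σ̂`. -/

namespace RealCurve

/-! ### Holomorphic linear differential equations, solved by power series. -/

section LinearODE

variable {𝔸 : Type*} [NormedRing 𝔸] [NormedAlgebra ℂ 𝔸]

/-- The Taylor coefficients of the solution of `W' = B W`, `W(0) = 1`, where `B = ∑ b k z ^ k`. -/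
noncomputable def odeCoeff (b : ℕ → 𝔸) : ℕ → 𝔸
  | 0 => 1
  | k + 1 => ((k : ℂ) + 1)⁻¹ • ∑ j : Fin (k + 1), b (k - j) * odeCoeff b j

/-- Summing over `Fin` lets the recursion terminate; the reflected sum over `range` matches the
Cauchy product of series. -/
lemma odeCoeff_succ (b : ℕ → 𝔸) (k : ℕ) :
    odeCoeff b (k + 1) =
      ((k : ℂ) + 1)⁻¹ • ∑ j ∈ Finset.range (k + 1), b j * odeCoeff b (k - j) := by
  rw [odeCoeff, Fin.sum_univ_eq_sum_range fun j => b (k - j) * odeCoeff b j,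
    ← Finset.sum_range_reflect]
  refine congrArg _ (Finset.sum_congr rfl fun j hj => ?_)
  have hj' : j ≤ k := Nat.lt_succ_iff.1 (Finset.mem_range.1 hj)
  rw [Nat.add_sub_cancel, Nat.sub_sub_self hj']

/-- The recursion has `k + 1` terms, each at most `‖1‖ * R ^ (k + 1)`, and the factor `(k + 1)⁻¹`
cancels their number. -/
lemma norm_odeCoeff_le {b : ℕ → 𝔸} {R : ℝ} (hR : 0 ≤ R) (hb : ∀ k, ‖b k‖ ≤ R ^ (k + 1)) (k : ℕ) :
    ‖odeCoeff b k‖ ≤ ‖(1 : 𝔸)‖ * R ^ k := by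
  induction k using Nat.strong_induction_on with
  | _ k ih =>
    cases k with
    | zero => simp [odeCoeff]
    | succ k =>
      rw [odeCoeff_succ, norm_smul, norm_inv]
      have hk : ‖(k : ℂ) + 1‖ = (k : ℝ) + 1 := by
        rw [← Nat.cast_succ, Complex.norm_natCast, Nat.cast_succ]
      rw [hk, inv_mul_le_iff₀ (by positivity)]
      calc ‖∑ j ∈ Finset.range (k + 1), b j * odeCoeff b (k - j)‖
          ≤ ∑ j ∈ Finset.range (k + 1), ‖(1 : 𝔸)‖ * R ^ (k + 1) := by
            refine norm_sum_le_of_le _ fun j hj => (norm_mul_le _ _).trans ?_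
            have hj' : j ≤ k := Nat.lt_succ_iff.1 (Finset.mem_range.1 hj)
            calc ‖b j‖ * ‖odeCoeff b (k - j)‖ ≤ R ^ (j + 1) * (‖(1 : 𝔸)‖ * R ^ (k - j)) :=
                  mul_le_mul (hb j) (ih _ (by omega)) (norm_nonneg _) (by positivity)
              _ = ‖(1 : 𝔸)‖ * R ^ (k + 1) := by
                  have : k + 1 = (j + 1) + (k - j) := by omega
                  rw [this, pow_add]
                  ring
        _ = ((k : ℝ) + 1) * (‖(1 : 𝔸)‖ * R ^ (k + 1)) := by simp

/-- A linear holomorphic differential equation `W' = B W` has a local solution. -/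
theorem exists_hasDerivAt_eq_mul [CompleteSpace 𝔸] {B : ℂ → 𝔸} {z₀ : ℂ} (hB : AnalyticAt ℂ B z₀) :
    ∃ W : ℂ → 𝔸, W z₀ = 1 ∧ ∀ᶠ z in nhds z₀, HasDerivAt W (B z * W z) z := by
  obtain ⟨p, hp⟩ := hB
  obtain ⟨r, hr0, hr⟩ := ENNReal.lt_iff_exists_nnreal_btwn.1 hp.radius_pos
  obtain ⟨C, hC, hbound⟩ := p.norm_mul_pow_le_of_lt_radius hr
  have hr0' : 0 < (r : ℝ) := by exact_mod_cast hr0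
  set b : ℕ → 𝔸 := p.coeff
  -- A single constant dominating both `C` and `r⁻¹` turns the bound `C * r⁻¹ ^ k` into `R ^ (k +
  -- 1)`, the form the recursion needs.
  set R : ℝ := max C (r : ℝ)⁻¹
  have hRpos : 0 < R := lt_max_of_lt_left hC
  have hb : ∀ k, ‖b k‖ ≤ R ^ (k + 1) := by
    intro k
    have h1 : ‖b k‖ ≤ C * (r : ℝ)⁻¹ ^ k := by
      rw [inv_pow, ← div_eq_mul_inv, le_div_iff₀ (by positivity), ← p.norm_apply_eq_norm_coef]
      exact hbound k
    calc ‖b k‖ ≤ C * (r : ℝ)⁻¹ ^ k := h1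
      _ ≤ R * R ^ k := by
        gcongr
        · exact le_max_left _ _
        · exact le_max_right _ _
      _ = R ^ (k + 1) := by ring
  have hw := norm_odeCoeff_le hRpos.le hb
  set w := odeCoeff b
  -- On the disc of radius `1 / (2R)` all series are dominated by geometric ones of ratio `1 / 2`.
  have hgeom : ∀ y : ℂ, ‖y‖ < (2 * R)⁻¹ → ∀ k, ‖y‖ ^ k * R ^ k ≤ (1 / 2 : ℝ) ^ k := by
    intro y hy k
    rw [← mul_pow]
    refine pow_le_pow_left₀ (by positivity) ?_ k
    calc ‖y‖ * R ≤ (2 * R)⁻¹ * R := by gcongr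
      _ = 1 / 2 := by field_simp
  have hsumW : ∀ y : ℂ, ‖y‖ < (2 * R)⁻¹ → Summable fun k => ‖y ^ k • w k‖ := by
    intro y hy
    refine Summable.of_nonneg_of_le (fun _ => norm_nonneg _) (fun k => ?_)
      ((summable_geometric_two).mul_left ‖(1 : 𝔸)‖)
    rw [norm_smul, norm_pow]
    calc ‖y‖ ^ k * ‖w k‖ ≤ ‖y‖ ^ k * (‖(1 : 𝔸)‖ * R ^ k) := by gcongr; exact hw k
      _ = ‖(1 : 𝔸)‖ * (‖y‖ ^ k * R ^ k) := by ring
      _ ≤ _ := by gcongr; exact hgeom y hy k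
  have hsumB : ∀ y : ℂ, ‖y‖ < (2 * R)⁻¹ → Summable fun k => ‖y ^ k • b k‖ := by
    intro y hy
    refine Summable.of_nonneg_of_le (fun _ => norm_nonneg _) (fun k => ?_)
      ((summable_geometric_two).mul_left R)
    rw [norm_smul, norm_pow]
    calc ‖y‖ ^ k * ‖b k‖ ≤ ‖y‖ ^ k * R ^ (k + 1) := by gcongr; exact hb k
      _ = R * (‖y‖ ^ k * R ^ k) := by ring
      _ ≤ _ := by gcongr; exact hgeom y hy k
  have hu : Summable fun k : ℕ => ‖(1 : 𝔸)‖ * (2 * R) * ((k : ℝ) * (1 / 2) ^ k) := by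
    have := summable_pow_mul_geometric_of_norm_lt_one (R := ℝ) 1 (r := 1 / 2) (by norm_num)
    exact (this.congr fun k => by simp).mul_left _
  have hder : ∀ y : ℂ, ‖y‖ < (2 * R)⁻¹ → ∀ k : ℕ, ‖((k : ℂ) * y ^ (k - 1)) • w k‖ ≤
      ‖(1 : 𝔸)‖ * (2 * R) * ((k : ℝ) * (1 / 2) ^ k) := by
    intro y hy k
    cases k with
    | zero => simp
    | succ k =>
      rw [norm_smul, norm_mul, norm_pow, Complex.norm_natCast, Nat.add_sub_cancel]
      calc ((k + 1 : ℕ) : ℝ) * ‖y‖ ^ k * ‖w (k + 1)‖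
          ≤ ((k + 1 : ℕ) : ℝ) * ‖y‖ ^ k * (‖(1 : 𝔸)‖ * R ^ (k + 1)) := by
            gcongr; exact hw (k + 1)
        _ = ‖(1 : 𝔸)‖ * R * ((k + 1 : ℕ) : ℝ) * (‖y‖ ^ k * R ^ k) := by ring
        _ ≤ ‖(1 : 𝔸)‖ * R * ((k + 1 : ℕ) : ℝ) * (1 / 2) ^ k := by gcongr; exact hgeom y hy k
        _ = _ := by ring
  let F : ℂ → 𝔸 := fun y => ∑' k : ℕ, y ^ k • w k
  have hF : ∀ y ∈ Metric.ball (0 : ℂ) (2 * R)⁻¹,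
      HasDerivAt F (∑' k : ℕ, ((k : ℂ) * y ^ (k - 1)) • w k) y := by
    intro y hy
    refine hasDerivAt_tsum_of_isPreconnected (t := Metric.ball (0 : ℂ) (2 * R)⁻¹) (y₀ := 0) hu
      Metric.isOpen_ball (convex_ball _ _).isPreconnected
      (fun k y _ => (hasDerivAt_pow k y).smul_const (w k))
      (fun k y hy => hder y (mem_ball_zero_iff.1 hy) k)
      (Metric.mem_ball_self (by positivity)) ?_ hy
    exact (hsumW 0 (by simpa using hRpos)).of_norm
  have hmul : ∀ y : ℂ, ‖y‖ < (2 * R)⁻¹ →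
      (∑' k : ℕ, ((k : ℂ) * y ^ (k - 1)) • w k) = (∑' k : ℕ, y ^ k • b k) * F y := by
    intro y hy
    have hS : Summable fun k : ℕ => ((k : ℂ) * y ^ (k - 1)) • w k :=
      Summable.of_norm_bounded hu (hder y hy)
    rw [hS.tsum_eq_zero_add,
      tsum_mul_tsum_eq_tsum_sum_range_of_summable_norm (hsumB y hy) (hsumW y hy)]
    simp only [Nat.cast_zero, zero_mul, zero_smul, zero_add, Nat.add_sub_cancel]
    refine tsum_congr fun k => ?_
    have hk : (k : ℂ) + 1 ≠ 0 := Nat.cast_add_one_ne_zero k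
    have hwk : w (k + 1) =
        ((k : ℂ) + 1)⁻¹ • ∑ j ∈ Finset.range (k + 1), b j * w (k - j) := odeCoeff_succ b k
    rw [hwk, smul_smul, Nat.cast_succ, mul_right_comm, mul_inv_cancel₀ hk, one_mul,
      Finset.smul_sum]
    refine Finset.sum_congr rfl fun j hj => ?_
    rw [smul_mul_smul_comm, ← pow_add, Nat.add_sub_cancel' (Nat.lt_succ_iff.1 (Finset.mem_range.1 hj))]
  refine ⟨fun z => F (z - z₀), ?_, ?_⟩
  · simp only [F, sub_self]
    rw [tsum_eq_single 0 fun k hk => by simp [hk]]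
    simp [w, odeCoeff]
  · have hcont : Filter.Tendsto (fun z : ℂ => z - z₀) (nhds z₀) (nhds 0) := by
      have : ContinuousAt (fun z : ℂ => z - z₀) z₀ := by fun_prop
      simpa [ContinuousAt] using this
    filter_upwards [hcont.eventually (hasFPowerSeriesAt_iff.1 hp),
      hcont.eventually (Metric.ball_mem_nhds (0 : ℂ) (ε := (2 * R)⁻¹) (by positivity))] with z h1 h2
    have h3 := (hF _ h2).comp_sub_const z z₀
    rw [hmul _ (mem_ball_zero_iff.1 h2)] at h3
    have h4 := h1.tsum_eq
    rw [add_sub_cancel] at h4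
    rwa [h4] at h3

end LinearODE

/-! ### Local unitary holomorphic frames of a flat metric. -/

section FlatFactorization

open scoped Matrix.Norms.L2Operator ComplexOrder MatrixOrder Topology

variable {n : ℕ}

lemma differentiableAt_matrix_complex {f : ℂ → Matrix (Fin n) (Fin n) ℂ} {z : ℂ} :
    DifferentiableAt ℂ f z ↔ ∀ i j, DifferentiableAt ℂ (fun w => f w i j) z := by
  refine ⟨fun h i j => ?_, fun h => ?_⟩
  · exact ((Matrix.entryLinearMap ℂ ℂ i j).toContinuousLinearMap.differentiableAt).comp z h
  · have : f = fun w => ∑ i, ∑ j, f w i j • Matrix.single i j (1 : ℂ) := by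
      funext w
      conv_lhs => rw [Matrix.matrix_eq_sum_single (f w)]
      simp
    rw [this]
    exact DifferentiableAt.fun_sum fun i _ => DifferentiableAt.fun_sum fun j _ =>
      (h i j).smul_const _

lemma differentiableAt_matrix_real {f : ℂ → Matrix (Fin n) (Fin n) ℂ} {z : ℂ} :
    DifferentiableAt ℝ f z ↔ ∀ i j, DifferentiableAt ℝ (fun w => f w i j) z := by
  refine ⟨fun h i j => ?_, fun h => ?_⟩
  · exact ((Matrix.entryLinearMap ℝ ℂ i j).toContinuousLinearMap.differentiableAt).comp z h
  · have : f = fun w => ∑ i, ∑ j, f w i j • Matrix.single i j (1 : ℂ) := by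
      funext w
      conv_lhs => rw [Matrix.matrix_eq_sum_single (f w)]
      simp
    rw [this]
    exact DifferentiableAt.fun_sum fun i _ => DifferentiableAt.fun_sum fun j _ =>
      (h i j).smul_const _

lemma fderiv_matrix_apply {f : ℂ → Matrix (Fin n) (Fin n) ℂ} {z : ℂ} (hf : DifferentiableAt ℝ f z)
    (v : ℂ) (i j : Fin n) : fderiv ℝ f z v i j = fderiv ℝ (fun w => f w i j) z v := by
  have h := ((Matrix.entryLinearMap ℝ ℂ i j).toContinuousLinearMap.hasFDerivAt).comp z
    hf.hasFDerivAt
  exact (congrArg (fun D : ℂ →L[ℝ] ℂ => D v) h.fderiv).symm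

lemma differentiableAt_of_dzbar_eq_zero {g : ℂ → ℂ} {z : ℂ} (hg : DifferentiableAt ℝ g z)
    (h : dzbar g z = 0) : DifferentiableAt ℂ g z := by
  refine differentiableAt_complex_iff_differentiableAt_real.2 ⟨hg, ?_⟩
  have h1 : fderiv ℝ g z 1 + Complex.I * fderiv ℝ g z Complex.I = 0 := by
    simpa [dzbar] using h
  rw [smul_eq_mul]
  linear_combination (-Complex.I) * h1 + fderiv ℝ g z Complex.I * Complex.I_mul_I

lemma differentiableAt_dz {g : ℂ → ℂ} {U : Set ℂ} (hU : IsOpen U) (hg : ContDiffOn ℝ ∞ g U) {z : ℂ}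
    (hz : z ∈ U) : DifferentiableAt ℝ (dz g) z := by
  have h1 : ContDiffAt ℝ 1 (fderiv ℝ g) z :=
    (hg.contDiffAt (hU.mem_nhds hz)).fderiv_right (by norm_cast)
  have h2 := h1.differentiableAt one_ne_zero
  unfold dz
  fun_prop

variable {H : ℂ → Matrix (Fin n) (Fin n) ℂ} {U : Set ℂ}

/-- The coefficient `H⁻¹ ∂H/∂z` of the Chern connection of the metric with Gram matrix `H`. -/
noncomputable def chernMatrix (H : ℂ → Matrix (Fin n) (Fin n) ℂ) (z : ℂ) :
    Matrix (Fin n) (Fin n) ℂ :=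
  (H z)⁻¹ * Matrix.of fun i j => dz (fun w => H w i j) z

/-- Zero curvature is the Cauchy-Riemann equation for the connection form, which can therefore serve
as coefficient of a holomorphic differential equation. -/
lemma differentiableAt_chernMatrix (hU : IsOpen U)
    (hsmooth : ∀ i j, ContDiffOn ℝ ∞ (fun z => H z i j) U) (hpos : ∀ z ∈ U, (H z).PosDef)
    (hflat : ∀ z ∈ U, ∀ i j, dzbar (fun w => chernMatrix H w i j) z = 0) {z : ℂ} (hz : z ∈ U) :
    DifferentiableAt ℂ (chernMatrix H) z := by
  have hH : DifferentiableAt ℝ H z := differentiableAt_matrix_real.2 fun i j =>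
    ((hsmooth i j).contDiffAt (hU.mem_nhds hz)).differentiableAt (by simp)
  have hinv : DifferentiableAt ℝ (fun w => (H w)⁻¹) z := by
    simp_rw [Matrix.nonsing_inv_eq_ringInverse]
    exact hH.inverse (hpos z hz).isUnit
  have hA : DifferentiableAt ℝ (chernMatrix H) z := by
    refine hinv.mul ?_
    exact differentiableAt_matrix_real.2 fun i j => differentiableAt_dz hU (hsmooth i j) hz
  exact differentiableAt_matrix_complex.2 fun i j =>
    differentiableAt_of_dzbar_eq_zero (differentiableAt_matrix_real.1 hA i j) (hflat z hz i j)

/-- If `∂L = 0` and `L` is hermitian, then `dL = 0`. -/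
lemma eq_zero_of_isHermitian_of_sub_eq_zero {D : ℂ →L[ℝ] Matrix (Fin n) (Fin n) ℂ}
    (hD : ∀ v, star (D v) = D v) (h : D 1 - Complex.I • D Complex.I = 0) : D = 0 := by
  have h1 : D 1 = Complex.I • D Complex.I := sub_eq_zero.1 h
  -- Taking adjoints in `h1` conjugates the factor `i` and fixes the hermitian values of `D`.
  have h2 : D 1 = -(Complex.I • D Complex.I) := by
    conv_lhs => rw [← hD 1, h1, star_smul, hD]
    simp
  have h3 : D 1 = 0 := by
    have : (2 : ℂ) • D 1 = 0 := by
      rw [two_smul]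
      nth_rewrite 1 [h1]
      rw [h2, add_neg_cancel]
    simpa using this
  have h4 : D Complex.I = 0 := by
    rw [h3] at h1
    simpa using h1.symm
  ext1 v
  have hv : v = v.re • (1 : ℂ) + v.im • Complex.I := Complex.ext (by simp) (by simp)
  rw [hv, map_add, map_smul, map_smul, h3, h4]
  simp

/-- The Gram matrix of a flat metric is locally `Gᴴ G` with `G` holomorphic and invertible. -/
theorem exists_holomorphic_factorization (hU : IsOpen U)
    (hsmooth : ∀ i j, ContDiffOn ℝ ∞ (fun z => H z i j) U) (hpos : ∀ z ∈ U, (H z).PosDef)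
    (hflat : ∀ z ∈ U, ∀ i j, dzbar (fun w => chernMatrix H w i j) z = 0) {z₀ : ℂ} (hz₀ : z₀ ∈ U) :
    ∃ G W : ℂ → Matrix (Fin n) (Fin n) ℂ, ∀ᶠ z in 𝓝 z₀, DifferentiableAt ℂ G z ∧
      DifferentiableAt ℂ W z ∧ G z * W z = 1 ∧ W z * G z = 1 ∧ H z = (G z).conjTranspose * G z := by
  -- With `A` the Chern form, a solution of `W' = -A W` is a holomorphic frame that is parallel, so
  -- the metric should be constant in it.
  have hA : AnalyticAt ℂ (fun z => -chernMatrix H z) z₀ :=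
    (DifferentiableOn.analyticAt (s := U) (fun z hz => (differentiableAt_chernMatrix hU hsmooth hpos
      hflat hz).differentiableWithinAt) (hU.mem_nhds hz₀)).neg
  obtain ⟨W, hW0, hW⟩ := exists_hasDerivAt_eq_mul hA
  obtain ⟨ε, hε, hball⟩ := Metric.eventually_nhds_iff_ball.1 (hW.and (hU.mem_nhds hz₀))
  have hL : ∀ z ∈ Metric.ball z₀ ε, HasFDerivAt (𝕜 := ℝ) (fun w => star (W w) * H w * W w) 0 z := by
    intro z hz
    obtain ⟨hWz, hzU⟩ := hball z hz
    have hH : DifferentiableAt ℝ H z := differentiableAt_matrix_real.2 fun i j =>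
      ((hsmooth i j).contDiffAt (hU.mem_nhds hzU)).differentiableAt (by simp)
    have hWd := hWz.hasFDerivAt.restrictScalars ℝ
    have hd := (hWd.star.mul' hH.hasFDerivAt).mul' hWd
    -- The left side is `2 ∂H`, and `∂H = H A`. As `∂(W*) = 0`, the two remaining terms of `∂(W* H
    -- W)` cancel.
    have hdH : fderiv ℝ H z 1 - Complex.I • fderiv ℝ H z Complex.I =
        (2 : ℂ) • (H z * chernMatrix H z) := by
      rw [chernMatrix, ← mul_assoc,
        Matrix.mul_nonsing_inv _ ((Matrix.isUnit_iff_isUnit_det _).1 (hpos z hzU).isUnit), one_mul]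
      ext i j
      simp [fderiv_matrix_apply hH, dz]
    refine hd.congr_fderiv (eq_zero_of_isHermitian_of_sub_eq_zero (fun v => ?_) ?_)
    · have hdv : star (fderiv ℝ H z v) = fderiv ℝ H z v := by
        have h1 : H =ᶠ[𝓝 z] fun w => star (H w) := by
          filter_upwards [hU.mem_nhds hzU] with w hw using (hpos w hw).isHermitian.symm
        have h2 := (hH.hasFDerivAt.star.congr_of_eventuallyEq h1).fderiv
        exact (congrArg (fun D : ℂ →L[ℝ] Matrix (Fin n) (Fin n) ℂ => D v) h2).symm
      have hHz : star (H z) = H z := (hpos z hzU).isHermitian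
      simp [hdv, hHz, mul_assoc]
      abel
    · have h1 : fderiv ℝ H z 1 =
          (2 : ℂ) • (H z * chernMatrix H z) + Complex.I • fderiv ℝ H z Complex.I := by
        rw [← hdH, sub_add_cancel]
      simp [mul_assoc, h1, smul_smul, mul_add, two_smul]
      abel
  have hconst : ∀ z ∈ Metric.ball z₀ ε, star (W z) * H z * W z = H z₀ := by
    intro z hz
    obtain ⟨a, ha⟩ := Metric.isOpen_ball.exists_is_const_of_fderiv_eq_zero (𝕜 := ℝ)
      (convex_ball z₀ ε).isPreconnected
      (fun z hz => (hL z hz).differentiableAt.differentiableWithinAt) fun z hz => (hL z hz).fderiv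
    have := (ha z hz).trans (ha z₀ (Metric.mem_ball_self hε)).symm
    rw [this, hW0]
    simp
  obtain ⟨B, hB⟩ := CStarAlgebra.nonneg_iff_eq_star_mul_self.1 (hpos z₀ hz₀).posSemidef.nonneg
  have hBu : IsUnit B := by
    have := (hpos z₀ hz₀).isUnit
    rw [hB] at this
    exact isUnit_of_mul_isUnit_right this
  have hWu : ∀ᶠ z in 𝓝 z₀, IsUnit (W z) := by
    have hc : ContinuousAt W z₀ := hW.self_of_nhds.continuousAt
    exact hc.eventually (Units.isOpen.mem_nhds (by rw [hW0]; exact isUnit_one))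
  -- From `W* H W = H z₀ = B* B` it follows that `H = G* G` with `G = B W⁻¹`.
  refine ⟨fun z => B * Ring.inverse (W z), fun z => W z * Ring.inverse B, ?_⟩
  filter_upwards [hW, hWu, Metric.ball_mem_nhds z₀ hε] with z hz1 hz2 hz3
  have h1 := Ring.mul_inverse_cancel _ hz2
  have h2 := Ring.inverse_mul_cancel _ hz2
  have h3 := Ring.mul_inverse_cancel _ hBu
  have h4 := Ring.inverse_mul_cancel _ hBu
  refine ⟨(hz1.differentiableAt.inverse hz2).const_mul B, hz1.differentiableAt.mul_const _, ?_, ?_,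
    ?_⟩
  · rw [mul_assoc, ← mul_assoc (Ring.inverse (W z)), h2, one_mul, h3]
  · rw [mul_assoc, ← mul_assoc (Ring.inverse B), h4, one_mul, h1]
  · have h5 := hconst z hz3
    have h6 : star (Ring.inverse (W z)) * star (W z) = 1 := by rw [← star_mul, h1, star_one]
    change _ = star _ * _
    calc H z = (star (Ring.inverse (W z)) * star (W z)) * H z * (W z * Ring.inverse (W z)) := by
          rw [h6, h1, one_mul, mul_one]
      _ = star (Ring.inverse (W z)) * (star (W z) * H z * W z) * Ring.inverse (W z) := by
          simp only [mul_assoc]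
      _ = _ := by rw [h5, hB, star_mul]; simp only [mul_assoc]

end FlatFactorization

/-! ### Linear algebra of one fibre: adjoints, spectra, real polynomials in an operator. -/

section HermitianForms

variable {V V' : Type*} [AddCommGroup V] [Module ℂ V] [AddCommGroup V'] [Module ℂ V']

/-- The inner product space structure defined by a positive definite hermitian form. -/
@[reducible]
def hermitianCore (B : V →ₗ⋆[ℂ] V →ₗ[ℂ] ℂ) (hB : ∀ v w, starRingEnd ℂ (B v w) = B w v)
    (hpos : ∀ v, v ≠ 0 → 0 < (B v v).re) : InnerProductSpace.Core ℂ V where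
  inner v w := B v w
  conj_inner_symm v w := hB w v
  re_inner_nonneg v := by
    by_cases hv : v = 0
    · simp [hv]
    · exact (hpos v hv).le
  add_left u v w := by simp
  smul_left v w r := by simp
  definite v hv := by
    by_contra hne
    have := hpos v hne
    rw [hv] at this
    simp at this

/-- `P` is `ψ* ψ`. The norms are installed only inside the proof, so that the conclusion involves
the forms alone and not the topology of the fibres. -/
theorem exists_adjoint_comp_self [FiniteDimensional ℂ V] [FiniteDimensional ℂ V']
    (B : V →ₗ⋆[ℂ] V →ₗ[ℂ] ℂ) (hB : ∀ v w, starRingEnd ℂ (B v w) = B w v)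
    (hpos : ∀ v, v ≠ 0 → 0 < (B v v).re)
    (B' : V' →ₗ⋆[ℂ] V' →ₗ[ℂ] ℂ) (hB' : ∀ v w, starRingEnd ℂ (B' v w) = B' w v)
    (hpos' : ∀ v, v ≠ 0 → 0 < (B' v v).re) (ψ : V →ₗ[ℂ] V') :
    ∃ P : V →ₗ[ℂ] V, ∀ v w, B v (P w) = B' (ψ v) (ψ w) := by
  let c := hermitianCore B hB hpos
  let c' := hermitianCore B' hB' hpos'
  let : NormedAddCommGroup V := c.toNormedAddCommGroup
  let : InnerProductSpace ℂ V := InnerProductSpace.ofCore c.toCore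
  let : NormedAddCommGroup V' := c'.toNormedAddCommGroup
  let : InnerProductSpace ℂ V' := InnerProductSpace.ofCore c'.toCore
  exact ⟨LinearMap.adjoint ψ ∘ₗ ψ, fun v w => LinearMap.adjoint_inner_right ψ v (ψ w)⟩

/-- A symmetric operator has a spanning set of eigenvectors, and `r(P)` acts on each by `r(μ) = 0`.
-/
theorem aeval_eq_zero_of_symmetric [FiniteDimensional ℂ V]
    (B : V →ₗ⋆[ℂ] V →ₗ[ℂ] ℂ) (hB : ∀ v w, starRingEnd ℂ (B v w) = B w v)
    (hpos : ∀ v, v ≠ 0 → 0 < (B v v).re) (P : V →ₗ[ℂ] V) (hP : ∀ v w, B (P v) w = B v (P w))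
    (r : Polynomial ℂ) (hr : ∀ μ, Module.End.HasEigenvalue P μ → r.eval μ = 0) :
    Polynomial.aeval P r = 0 := by
  let c := hermitianCore B hB hpos
  let : NormedAddCommGroup V := c.toNormedAddCommGroup
  let : InnerProductSpace ℂ V := InnerProductSpace.ofCore c.toCore
  have hsym : P.IsSymmetric := hP
  have htop : (⨆ μ, Module.End.eigenspace P μ) = ⊤ :=
    Submodule.orthogonal_eq_bot_iff.1 hsym.orthogonalComplement_iSup_eigenspaces_eq_bot
  rw [← LinearMap.ker_eq_top, eq_top_iff, ← htop, iSup_le_iff]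
  intro μ v hv
  by_cases h0 : v = 0
  · simp [h0]
  · have hvec : Module.End.HasEigenvector P μ v := ⟨hv, h0⟩
    rw [LinearMap.mem_ker, Module.End.aeval_apply_of_hasEigenvector hvec,
      hr μ (Module.End.hasEigenvalue_of_hasEigenvector hvec), zero_smul]

/-- Eigenvalues of a positive operator are positive real numbers. -/
theorem eigenvalue_pos (B : V →ₗ⋆[ℂ] V →ₗ[ℂ] ℂ)
    (hB : ∀ v w, starRingEnd ℂ (B v w) = B w v)
    (hpos : ∀ v, v ≠ 0 → 0 < (B v v).re)
    (B' : V' →ₗ⋆[ℂ] V' →ₗ[ℂ] ℂ) (hB' : ∀ v w, starRingEnd ℂ (B' v w) = B' w v)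
    (hpos' : ∀ v, v ≠ 0 → 0 < (B' v v).re) (ψ : V ≃ₗ[ℂ] V') {P : V →ₗ[ℂ] V}
    (hP : ∀ v w, B v (P w) = B' (ψ v) (ψ w)) {μ : ℂ} (hμ : Module.End.HasEigenvalue P μ) :
    0 < μ.re ∧ (μ.re : ℂ) = μ := by
  obtain ⟨v, hv⟩ := hμ.exists_hasEigenvector
  have h1 := hP v v
  rw [hv.apply_eq_smul, map_smul, smul_eq_mul] at h1
  have e1 : ((B v v).re : ℂ) = B v v := Complex.conj_eq_iff_re.1 (hB v v)
  have e2 : ((B' (ψ v) (ψ v)).re : ℂ) = B' (ψ v) (ψ v) := Complex.conj_eq_iff_re.1 (hB' _ _)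
  have p1 := hpos v hv.2
  have p2 := hpos' (ψ v) (by simpa using hv.2)
  -- For an eigenvector `v`, the eigenvalue is the ratio of the squared norms of `ψ v` and `v`.
  have h2 : μ = (((B' (ψ v) (ψ v)).re / (B v v).re : ℝ) : ℂ) := by
    have : (B v v) ≠ 0 := by rw [← e1]; exact_mod_cast p1.ne'
    rw [Complex.ofReal_div, e1, e2, ← h1, mul_div_cancel_right₀ _ this]
  rw [h2]
  exact ⟨by rw [Complex.ofReal_re]; positivity, by rw [Complex.ofReal_re]⟩

/-- A real polynomial interpolating `t ↦ 1 / √t` on a finite set of positive numbers. -/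
theorem exists_polynomial_inv_sqrt (S : Finset ℝ) (hS : ∀ t ∈ S, 0 < t) :
    ∃ q : Polynomial ℝ, ∀ t ∈ S, q.eval t * (t * q.eval t) = 1 := by
  refine ⟨Lagrange.interpolate S id fun t => (√t)⁻¹, fun t ht => ?_⟩
  have h := Lagrange.eval_interpolate_at_node (v := id) (fun t : ℝ => (√t)⁻¹)
    Function.injective_id.injOn ht
  simp only [id] at h
  rw [h]
  have h1 : 0 < √t := Real.sqrt_pos.2 (hS t ht)
  field_simp
  rw [Real.sq_sqrt (hS t ht).le]

/-- A real polynomial in a symmetric operator is symmetric. -/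
theorem aeval_symmetric (B : V →ₗ⋆[ℂ] V →ₗ[ℂ] ℂ) {P : V →ₗ[ℂ] V}
    (hP : ∀ v w, B (P v) w = B v (P w)) (q : Polynomial ℝ) (v w : V) :
    B (Polynomial.aeval P (q.map (algebraMap ℝ ℂ)) v) w =
      B v (Polynomial.aeval P (q.map (algebraMap ℝ ℂ)) w) := by
  have hpow : ∀ (k : ℕ) v w, B ((P ^ k) v) w = B v ((P ^ k) w) := by
    intro k
    induction k with
    | zero => simp
    | succ k ih => intro v w; rw [pow_succ, Module.End.mul_apply, ih, hP, ← Module.End.mul_apply,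
        ← pow_succ', pow_succ]
  induction q using Polynomial.induction_on' with
  | add p q hp hq => simp only [Polynomial.map_add, map_add, LinearMap.add_apply, hp, hq]
  | monomial k a =>
    simp only [Polynomial.map_monomial, Polynomial.aeval_monomial, Module.End.mul_apply,
      Module.algebraMap_end_apply, map_smulₛₗ, LinearMap.smul_apply, hpow]
    simp

/-- An antilinear map intertwining two operators intertwines their values under a real
polynomial. -/
theorem aeval_semiconj {P : V →ₗ[ℂ] V} {P' : V' →ₗ[ℂ] V'} (s : V →ₗ⋆[ℂ] V')
    (hs : ∀ v, s (P v) = P' (s v)) (q : Polynomial ℝ) (v : V) :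
    s (Polynomial.aeval P (q.map (algebraMap ℝ ℂ)) v) =
      Polynomial.aeval P' (q.map (algebraMap ℝ ℂ)) (s v) := by
  have hpow : ∀ (k : ℕ) v, s ((P ^ k) v) = (P' ^ k) (s v) := by
    intro k
    induction k with
    | zero => simp
    | succ k ih => intro v; rw [pow_succ, Module.End.mul_apply, ih, hs, ← Module.End.mul_apply,
        ← pow_succ]
  induction q using Polynomial.induction_on' with
  | add p q hp hq => simp only [Polynomial.map_add, map_add, LinearMap.add_apply, hp, hq]
  | monomial k a =>
    simp only [Polynomial.map_monomial, Polynomial.aeval_monomial, Module.End.mul_apply,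
      Module.algebraMap_end_apply, map_smulₛₗ, hpow]
    simp

end HermitianForms

/-! ### Families of linear maps and their local matrices. -/

section LocalMatrix

open scoped Matrix.Norms.L2Operator Topology

variable {X : Type*} [TopologicalSpace X] [ChartedSpace ℂ X] {n : ℕ}
  {E : X → Type*} [∀ x, TopologicalSpace (E x)] [∀ x, AddCommGroup (E x)] [∀ x, Module ℂ (E x)]
  [TopologicalSpace (TotalSpace (Fin n → ℂ) E)] [FiberBundle (Fin n → ℂ) E]
  [VectorBundle ℂ (Fin n → ℂ) E]
  {E' : X → Type*} [∀ x, TopologicalSpace (E' x)] [∀ x, AddCommGroup (E' x)]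
  [∀ x, Module ℂ (E' x)]
  [TopologicalSpace (TotalSpace (Fin n → ℂ) E')] [FiberBundle (Fin n → ℂ) E']
  [VectorBundle ℂ (Fin n → ℂ) E']
  {E'' : X → Type*} [∀ x, TopologicalSpace (E'' x)] [∀ x, AddCommGroup (E'' x)]
  [∀ x, Module ℂ (E'' x)]
  [TopologicalSpace (TotalSpace (Fin n → ℂ) E'')] [FiberBundle (Fin n → ℂ) E'']
  [VectorBundle ℂ (Fin n → ℂ) E'']

variable (n) in
/-- The matrix of a family of linear maps in the preferred trivializations at `x₀`, as a function
of the coordinate of the preferred chart. -/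
noncomputable def localMatrix (φ : ∀ x, E x →ₗ[ℂ] E' x) (x₀ : X) (z : ℂ) : Matrix (Fin n) (Fin n) ℂ :=
  LinearMap.toMatrix'
    ((trivializationAt (Fin n → ℂ) E' x₀).linearMapAt ℂ ((chartAt ℂ x₀).symm z) ∘ₗ
      φ ((chartAt ℂ x₀).symm z) ∘ₗ
      (trivializationAt (Fin n → ℂ) E x₀).symmₗ ℂ ((chartAt ℂ x₀).symm z))

variable (n) in
/-- A family of linear maps is holomorphic if its local matrices are. -/
def IsHolomorphicFamily (φ : ∀ x, E x →ₗ[ℂ] E' x) : Prop :=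
  ∀ x₀ : X, DifferentiableAt ℂ (localMatrix n φ x₀) (chartAt ℂ x₀ x₀)

variable (n) in
/-- The map of total spaces defined by a family of linear maps. -/
def totalFamily (φ : ∀ x, E x →ₗ[ℂ] E' x) (p : TotalSpace (Fin n → ℂ) E) :
    TotalSpace (Fin n → ℂ) E' :=
  ⟨p.1, φ p.1 p.2⟩

variable (n E) in
lemma isOpen_coordDomain (x₀ : X) : IsOpen (coordDomain n E x₀) :=
  (chartAt ℂ x₀).isOpen_inter_preimage_symm
    (trivializationAt (Fin n → ℂ) E x₀).open_baseSet

variable (n E) in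
lemma mem_coordDomain (x₀ : X) : chartAt ℂ x₀ x₀ ∈ coordDomain n E x₀ :=
  ⟨mem_chart_target ℂ x₀, by
    rw [(chartAt ℂ x₀).left_inv (mem_chart_source ℂ x₀)]
    exact FiberBundle.mem_baseSet_trivializationAt' x₀⟩

variable (n E) in
lemma eventually_mem_coordDomain (x₀ : X) :
    ∀ᶠ z in 𝓝 (chartAt ℂ x₀ x₀), z ∈ coordDomain n E x₀ :=
  (isOpen_coordDomain n E x₀).mem_nhds (mem_coordDomain n E x₀)

lemma tendsto_chartAt (x₀ : X) : Filter.Tendsto (chartAt ℂ x₀) (𝓝 x₀) (𝓝 (chartAt ℂ x₀ x₀)) :=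
  (chartAt ℂ x₀).continuousAt (mem_chart_source ℂ x₀)

/-- A property which holds near the coordinate of `x₀` holds near `x₀`. -/
lemma eventually_of_chart {x₀ : X} {p : X → Prop}
    (h : ∀ᶠ z in 𝓝 (chartAt ℂ x₀ x₀), p ((chartAt ℂ x₀).symm z)) : ∀ᶠ x in 𝓝 x₀, p x := by
  filter_upwards [(tendsto_chartAt x₀).eventually h,
    (chartAt ℂ x₀).open_source.mem_nhds (mem_chart_source ℂ x₀)] with x hx hs
  rwa [(chartAt ℂ x₀).left_inv hs] at hx

lemma localMatrix_apply {φ : ∀ x, E x →ₗ[ℂ] E' x} {x₀ : X} {z : ℂ} (hz : z ∈ coordDomain n E x₀)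
    (hz' : z ∈ coordDomain n E' x₀) (i j : Fin n) : localMatrix n φ x₀ z i j =
      (trivializationAt (Fin n → ℂ) E' x₀ ⟨(chartAt ℂ x₀).symm z,
        φ ((chartAt ℂ x₀).symm z) (localFrame n E x₀ j z)⟩).2 i := by
  rw [localMatrix, LinearMap.toMatrix'_apply]
  simp only [LinearMap.comp_apply, localFrame]
  rw [Trivialization.linearMapAt_apply, if_pos hz'.2, Trivialization.symmₗ_apply _ hz.2]

lemma localMatrix_mulVec (φ : ∀ x, E x →ₗ[ℂ] E' x) (x₀ : X) (z : ℂ) (v : Fin n → ℂ) :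
    (localMatrix n φ x₀ z).mulVec v =
      (trivializationAt (Fin n → ℂ) E' x₀).linearMapAt ℂ ((chartAt ℂ x₀).symm z)
        (φ _ ((trivializationAt (Fin n → ℂ) E x₀).symmₗ ℂ ((chartAt ℂ x₀).symm z) v)) := by
  rw [localMatrix, LinearMap.toMatrix'_mulVec]
  rfl

lemma localMatrix_comp (χ : ∀ x, E' x →ₗ[ℂ] E'' x) (φ : ∀ x, E x →ₗ[ℂ] E' x) {x₀ : X} {z : ℂ}
    (hz : z ∈ coordDomain n E' x₀) :
    localMatrix n (fun x => χ x ∘ₗ φ x) x₀ z = localMatrix n χ x₀ z * localMatrix n φ x₀ z := by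
  simp only [localMatrix]
  rw [← LinearMap.toMatrix'_comp]
  congr 1
  refine LinearMap.ext fun v => ?_
  simp only [LinearMap.comp_apply]
  rw [Trivialization.symmₗ_linearMapAt _ hz.2]

lemma localMatrix_id {x₀ : X} {z : ℂ} (hz : z ∈ coordDomain n E x₀) :
    localMatrix n (fun x => (LinearMap.id : E x →ₗ[ℂ] E x)) x₀ z = 1 := by
  rw [localMatrix, ← LinearMap.toMatrix'_id]
  congr 1
  refine LinearMap.ext fun v => ?_
  simp only [LinearMap.comp_apply, LinearMap.id_apply]
  rw [Trivialization.linearMapAt_symmₗ _ hz.2]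

lemma localMatrix_add (φ χ : ∀ x, E x →ₗ[ℂ] E' x) (x₀ : X) (z : ℂ) :
    localMatrix n (fun x => φ x + χ x) x₀ z = localMatrix n φ x₀ z + localMatrix n χ x₀ z := by
  simp only [localMatrix, LinearMap.add_comp, LinearMap.comp_add, map_add]

lemma localMatrix_smul (a : ℂ) (φ : ∀ x, E x →ₗ[ℂ] E' x) (x₀ : X) (z : ℂ) :
    localMatrix n (fun x => a • φ x) x₀ z = a • localMatrix n φ x₀ z := by
  simp only [localMatrix, LinearMap.smul_comp, LinearMap.comp_smul, map_smul]

namespace IsHolomorphicFamily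

lemma comp {χ : ∀ x, E' x →ₗ[ℂ] E'' x} {φ : ∀ x, E x →ₗ[ℂ] E' x}
    (hχ : IsHolomorphicFamily n χ) (hφ : IsHolomorphicFamily n φ) :
    IsHolomorphicFamily n fun x => χ x ∘ₗ φ x := by
  intro x₀
  refine ((hχ x₀).mul (hφ x₀)).congr_of_eventuallyEq ?_
  filter_upwards [eventually_mem_coordDomain n E' x₀] with z hz using localMatrix_comp χ φ hz

lemma add {φ χ : ∀ x, E x →ₗ[ℂ] E' x} (hφ : IsHolomorphicFamily n φ)
    (hχ : IsHolomorphicFamily n χ) : IsHolomorphicFamily n fun x => φ x + χ x := by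
  intro x₀
  exact ((hφ x₀).add (hχ x₀)).congr_of_eventuallyEq
    (Filter.Eventually.of_forall fun z => localMatrix_add φ χ x₀ z)

lemma const_smul (a : ℂ) {φ : ∀ x, E x →ₗ[ℂ] E' x} (hφ : IsHolomorphicFamily n φ) :
    IsHolomorphicFamily n fun x => a • φ x := by
  intro x₀
  exact ((hφ x₀).const_smul a).congr_of_eventuallyEq
    (Filter.Eventually.of_forall fun z => localMatrix_smul a φ x₀ z)

variable (n E) in
lemma id : IsHolomorphicFamily n fun x => (LinearMap.id : E x →ₗ[ℂ] E x) := by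
  intro x₀
  refine (differentiableAt_const (1 : Matrix (Fin n) (Fin n) ℂ)).congr_of_eventuallyEq ?_
  filter_upwards [eventually_mem_coordDomain n E x₀] with z hz using localMatrix_id hz

lemma symm {φ : ∀ x, E x ≃ₗ[ℂ] E' x} (hφ : IsHolomorphicFamily n fun x => (φ x).toLinearMap) :
    IsHolomorphicFamily n fun x => (φ x).symm.toLinearMap := by
  intro x₀
  -- The local matrix of the inverse is the inverse matrix, and inversion is differentiable at a
  -- unit.
  have key : ∀ᶠ z in 𝓝 (chartAt ℂ x₀ x₀),
      localMatrix n (fun x => (φ x).toLinearMap) x₀ z *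
        localMatrix n (fun x => (φ x).symm.toLinearMap) x₀ z = 1 := by
    filter_upwards [eventually_mem_coordDomain n E x₀, eventually_mem_coordDomain n E' x₀]
      with z hz hz'
    rw [← localMatrix_comp _ _ hz, ← localMatrix_id hz']
    congr 1
    funext x
    ext v
    simp
  have hunit := IsUnit.of_mul_eq_one _ key.self_of_nhds
  refine ((hφ x₀).inverse hunit).congr_of_eventuallyEq ?_
  filter_upwards [key] with z hz
  rw [← Matrix.nonsing_inv_eq_ringInverse]
  exact (Matrix.inv_eq_right_inv hz).symm

lemma aeval {P : ∀ x, E x →ₗ[ℂ] E x} (hP : IsHolomorphicFamily n P) (q : Polynomial ℂ) :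
    IsHolomorphicFamily n fun x => Polynomial.aeval (P x) q := by
  have hpow : ∀ k : ℕ, IsHolomorphicFamily n fun x => P x ^ k := by
    intro k
    induction k with
    | zero => simpa using! id n E
    | succ k ih => simpa only [pow_succ] using! ih.comp hP
  induction q using Polynomial.induction_on' with
  | add p q hp hq => simpa only [map_add] using hp.add hq
  | monomial k a =>
    simp only [Polynomial.aeval_monomial, Algebra.algebraMap_eq_smul_one, smul_mul_assoc, one_mul]
    exact (hpow k).const_smul a

end IsHolomorphicFamily

/-- For an endomorphism the same trivialization appears at both ends; determinant and trace are thus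
independent of the frame and define global functions on `X`. -/
lemma localMatrix_eq_conj (Q : ∀ x, E x →ₗ[ℂ] E x) {x₀ : X} {z : ℂ}
    (hz : z ∈ coordDomain n E x₀) :
    localMatrix n Q x₀ z = LinearMap.toMatrix' (((trivializationAt (Fin n → ℂ) E x₀).linearEquivAt ℂ
      ((chartAt ℂ x₀).symm z) hz.2).conj (Q ((chartAt ℂ x₀).symm z))) := by
  rw [localMatrix]
  congr 1
  refine LinearMap.ext fun v => ?_
  simp only [LinearMap.comp_apply, LinearEquiv.conj_apply_apply]
  rw [Trivialization.linearMapAt_apply, if_pos hz.2, Trivialization.symmₗ_apply _ hz.2,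
    Trivialization.linearEquivAt_apply, Trivialization.linearEquivAt_symm_apply]

lemma det_localMatrix (Q : ∀ x, E x →ₗ[ℂ] E x) {x₀ : X} {z : ℂ} (hz : z ∈ coordDomain n E x₀) :
    (localMatrix n Q x₀ z).det = LinearMap.det (Q ((chartAt ℂ x₀).symm z)) := by
  rw [localMatrix_eq_conj Q hz, LinearMap.det_toMatrix']
  exact LinearMap.det_conj (Q ((chartAt ℂ x₀).symm z))
    ((trivializationAt (Fin n → ℂ) E x₀).linearEquivAt ℂ ((chartAt ℂ x₀).symm z) hz.2)

lemma trace_localMatrix (Q : ∀ x, E x →ₗ[ℂ] E x) {x₀ : X} {z : ℂ}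
    (hz : z ∈ coordDomain n E x₀) :
    (localMatrix n Q x₀ z).trace = LinearMap.trace ℂ _ (Q ((chartAt ℂ x₀).symm z)) := by
  rw [localMatrix_eq_conj Q hz, ← Matrix.trace_toLin'_eq, Matrix.toLin'_toMatrix',
    LinearMap.trace_conj']

end LocalMatrix

/-! ### Holomorphic families and holomorphic maps of total spaces. -/

section TotalSpaces

open scoped Matrix.Norms.L2Operator Topology

variable {X : Type*} [TopologicalSpace X] [ChartedSpace ℂ X] [IsManifold 𝓘(ℂ, ℂ) ω X] {n : ℕ}
  {E : X → Type*} [∀ x, TopologicalSpace (E x)] [∀ x, AddCommGroup (E x)] [∀ x, Module ℂ (E x)]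
  [TopologicalSpace (TotalSpace (Fin n → ℂ) E)] [FiberBundle (Fin n → ℂ) E]
  [VectorBundle ℂ (Fin n → ℂ) E] [ContMDiffVectorBundle ω (Fin n → ℂ) E 𝓘(ℂ, ℂ)]
  {E' : X → Type*} [∀ x, TopologicalSpace (E' x)] [∀ x, AddCommGroup (E' x)]
  [∀ x, Module ℂ (E' x)]
  [TopologicalSpace (TotalSpace (Fin n → ℂ) E')] [FiberBundle (Fin n → ℂ) E']
  [VectorBundle ℂ (Fin n → ℂ) E'] [ContMDiffVectorBundle ω (Fin n → ℂ) E' 𝓘(ℂ, ℂ)]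

/-- `IsHolomorphicFamily` tests a local matrix only at the centre of its chart. Holomorphy on the
total space yields the nearby points too, which the maximum principle requires. -/
lemma differentiableAt_localMatrix {φ : ∀ x, E x →ₗ[ℂ] E' x}
    (hφ : MDifferentiable (𝓘(ℂ, ℂ).prod 𝓘(ℂ, Fin n → ℂ)) (𝓘(ℂ, ℂ).prod 𝓘(ℂ, Fin n → ℂ))
      (totalFamily n φ)) {x₀ : X} {z : ℂ} (hz : z ∈ coordDomain n E x₀)
    (hz' : z ∈ coordDomain n E' x₀) : DifferentiableAt ℂ (localMatrix n φ x₀) z := by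
  have : IsManifold 𝓘(ℂ, ℂ) 1 X := IsManifold.of_le (n := ω) le_top
  refine differentiableAt_matrix_complex.2 fun i j => ?_
  set c := chartAt ℂ x₀
  set e := trivializationAt (Fin n → ℂ) E x₀
  set e' := trivializationAt (Fin n → ℂ) E' x₀
  have h1 : MDifferentiableAt 𝓘(ℂ, ℂ) 𝓘(ℂ, ℂ) c.symm z :=
    mdifferentiableAt_atlas_symm (chart_mem_atlas ℂ x₀) hz.1
  have h2 : MDifferentiableAt 𝓘(ℂ, ℂ) (𝓘(ℂ, ℂ).prod 𝓘(ℂ, Fin n → ℂ))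
      (fun w => (c.symm w, (Pi.single j 1 : Fin n → ℂ))) z := h1.prodMk mdifferentiableAt_const
  have h3 : MDifferentiableAt (𝓘(ℂ, ℂ).prod 𝓘(ℂ, Fin n → ℂ)) (𝓘(ℂ, ℂ).prod 𝓘(ℂ, Fin n → ℂ))
      e.toOpenPartialHomeomorph.symm (c.symm z, (Pi.single j 1 : Fin n → ℂ)) :=
    ((Trivialization.contMDiffOn_symm (n := ω) (IB := 𝓘(ℂ, ℂ)) e).contMDiffAt
      (e.open_target.mem_nhds (e.mem_target.2 hz.2))).mdifferentiableAt (by simp)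
  have h4 : totalFamily n φ (e.toOpenPartialHomeomorph.symm
      (c.symm z, (Pi.single j 1 : Fin n → ℂ))) ∈ e'.source := by
    rw [e'.mem_source]
    have := e.proj_symm_apply (e.mem_target.2 hz.2 : (c.symm z, (Pi.single j 1 : Fin n → ℂ)) ∈ _)
    change (e.toOpenPartialHomeomorph.symm (c.symm z, (Pi.single j 1 : Fin n → ℂ))).proj ∈ _
    rw [this]
    exact hz'.2
  have h5 : MDifferentiableAt (𝓘(ℂ, ℂ).prod 𝓘(ℂ, Fin n → ℂ)) (𝓘(ℂ, ℂ).prod 𝓘(ℂ, Fin n → ℂ))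
      e' (totalFamily n φ (e.toOpenPartialHomeomorph.symm
        (c.symm z, (Pi.single j 1 : Fin n → ℂ)))) :=
    ((Trivialization.contMDiffOn (n := ω) (IB := 𝓘(ℂ, ℂ)) e').contMDiffAt
      (e'.open_source.mem_nhds h4)).mdifferentiableAt (by simp)
  have h6 := mdifferentiableAt_snd.comp z (h5.comp z ((hφ _).comp z (h3.comp z h2)))
  have h7 := (differentiableAt_pi.1 (mdifferentiableAt_iff_differentiableAt.1 h6)) i
  refine h7.congr_of_eventuallyEq ?_
  filter_upwards [(isOpen_coordDomain n E x₀).mem_nhds hz,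
    (isOpen_coordDomain n E' x₀).mem_nhds hz'] with w hw hw'
  rw [localMatrix_apply hw hw']
  exact congrArg (fun t => (e' (totalFamily n φ t)).2 i) (e.mk_symm hw.2 (Pi.single j 1))

lemma isHolomorphicFamily_of_mdifferentiable {φ : ∀ x, E x →ₗ[ℂ] E' x}
    (hφ : MDifferentiable (𝓘(ℂ, ℂ).prod 𝓘(ℂ, Fin n → ℂ)) (𝓘(ℂ, ℂ).prod 𝓘(ℂ, Fin n → ℂ))
      (totalFamily n φ)) : IsHolomorphicFamily n φ :=
  fun x₀ => differentiableAt_localMatrix hφ (mem_coordDomain n E x₀) (mem_coordDomain n E' x₀)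

/-- In the trivializations preferred at the base point of `p`, the fibre component is `(z, v) ↦ M(z)
v`, so differentiability of `M` at the centre suffices. -/
lemma IsHolomorphicFamily.mdifferentiable {φ : ∀ x, E x →ₗ[ℂ] E' x}
    (hφ : IsHolomorphicFamily n φ) :
    MDifferentiable (𝓘(ℂ, ℂ).prod 𝓘(ℂ, Fin n → ℂ)) (𝓘(ℂ, ℂ).prod 𝓘(ℂ, Fin n → ℂ))
      (totalFamily n φ) := by
  have : IsManifold 𝓘(ℂ, ℂ) 1 X := IsManifold.of_le (n := ω) le_top
  intro p
  refine (mdifferentiableAt_totalSpace 𝓘(ℂ, ℂ) (totalFamily n φ)).2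
    ⟨mdifferentiableAt_proj E, ?_⟩
  set c := chartAt ℂ p.1
  set e := trivializationAt (Fin n → ℂ) E p.1 with he
  have hpe : p ∈ e.source := e.mem_source.2 (FiberBundle.mem_baseSet_trivializationAt' p.1)
  have h1 : MDifferentiableAt (𝓘(ℂ, ℂ).prod 𝓘(ℂ, Fin n → ℂ)) 𝓘(ℂ, ℂ)
      (fun q : TotalSpace (Fin n → ℂ) E => c q.1) p :=
    (mdifferentiableAt_atlas (chart_mem_atlas ℂ p.1) (mem_chart_source ℂ p.1)).comp p
      (mdifferentiableAt_proj E)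
  have h2 : MDifferentiableAt (𝓘(ℂ, ℂ).prod 𝓘(ℂ, Fin n → ℂ)) 𝓘(ℂ, Fin n → ℂ)
      (fun q : TotalSpace (Fin n → ℂ) E => (e q).2) p :=
    mdifferentiableAt_snd.comp p (((Trivialization.contMDiffOn (n := ω) (IB := 𝓘(ℂ, ℂ)) e).contMDiffAt
      (e.open_source.mem_nhds hpe)).mdifferentiableAt (by simp))
  have h3 : DifferentiableAt ℂ
      (fun w : ℂ × (Fin n → ℂ) => (localMatrix n φ p.1 w.1).mulVec w.2) (c p.1, (e p).2) := by
    refine differentiableAt_pi.2 fun i => ?_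
    simp only [Matrix.mulVec, dotProduct]
    refine DifferentiableAt.fun_sum fun j _ => ?_
    have h4 := differentiableAt_matrix_complex.1 (hφ p.1) i j
    have h5 : DifferentiableAt ℂ (fun w : ℂ × (Fin n → ℂ) => localMatrix n φ p.1 w.1 i j)
        (c p.1, (e p).2) := 
      DifferentiableAt.comp (g := fun w => localMatrix n φ p.1 w i j) (c p.1, (e p).2) h4
        differentiableAt_fst
    refine h5.mul ?_
    fun_prop
  have h6 := DifferentiableAt.comp_mdifferentiableAt (x := p)
    (f := fun q : TotalSpace (Fin n → ℂ) E => (c q.1, (e q).2)) h3 (h1.prodMk_space h2)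
  refine h6.congr_of_eventuallyEq ?_
  have h7 : Filter.Tendsto (fun q : TotalSpace (Fin n → ℂ) E => q.1) (𝓝 p) (𝓝 p.1) :=
    (FiberBundle.continuous_proj (Fin n → ℂ) E).continuousAt
  filter_upwards [h7.eventually ((tendsto_chartAt p.1).eventually
      (eventually_mem_coordDomain n E p.1)),
    h7.eventually ((tendsto_chartAt p.1).eventually (eventually_mem_coordDomain n E' p.1)),
    h7.eventually (c.open_source.mem_nhds (mem_chart_source ℂ p.1))] with q hq hq' hqs
  simp only [Function.comp_apply]
  rw [localMatrix_mulVec, Trivialization.linearMapAt_apply, if_pos hq'.2]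
  have h8 : c.symm (c q.1) = q.1 := c.left_inv hqs
  have hq2 := hq.2
  -- The fibre depends on the base point, so the equality `c.symm (c q.1) = q.1` is used by
  -- substituting a variable `y`.
  have aux : ∀ y, y = q.1 → y ∈ e.baseSet → (⟨y, φ y (e.symmₗ ℂ y (e q).2)⟩ :
      TotalSpace (Fin n → ℂ) E') = totalFamily n φ q := by
    rintro y rfl hy
    rw [Trivialization.symmₗ_apply _ hy, e.symm_apply_apply_mk hy]
    rfl
  exact congrArg (fun t => (trivializationAt (Fin n → ℂ) E' p.1 t).2) (aux _ h8 hq2).symm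

/-- The characteristic polynomial of a holomorphic endomorphism is constant. -/
theorem det_smul_sub_eq [CompactSpace X] [ConnectedSpace X] {Q : ∀ x, E x →ₗ[ℂ] E x}
    (hQ : IsHolomorphicFamily n Q) (μ : ℂ) (x y : X) :
    LinearMap.det (μ • LinearMap.id - Q x) = LinearMap.det (μ • LinearMap.id - Q y) := by
  have : IsManifold 𝓘(ℂ, ℂ) 1 X := IsManifold.of_le (n := ω) le_top
  have h : IsHolomorphicFamily n fun x => μ • (LinearMap.id : E x →ₗ[ℂ] E x) + (-1 : ℂ) • Q x :=
    ((IsHolomorphicFamily.id n E).const_smul μ).add (hQ.const_smul (-1))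
  have hM : MDifferentiable 𝓘(ℂ, ℂ) 𝓘(ℂ, ℂ)
      fun x => LinearMap.det (μ • (LinearMap.id : E x →ₗ[ℂ] E x) + (-1 : ℂ) • Q x) := by
    intro x₀
    have h1 : DifferentiableAt ℂ (fun z => (localMatrix n
        (fun x => μ • (LinearMap.id : E x →ₗ[ℂ] E x) + (-1 : ℂ) • Q x) x₀ z).det)
        (chartAt ℂ x₀ x₀) := by
      simp only [Matrix.det_apply]
      refine DifferentiableAt.fun_sum fun g _ => DifferentiableAt.const_smul ?_ _
      exact DifferentiableAt.fun_finsetProd fun i _ => differentiableAt_matrix_complex.1 (h x₀) _ _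
    have h2 : MDifferentiableAt 𝓘(ℂ, ℂ) 𝓘(ℂ, ℂ) (chartAt ℂ x₀) x₀ :=
      mdifferentiableAt_atlas (chart_mem_atlas ℂ x₀) (mem_chart_source ℂ x₀)
    refine (h1.comp_mdifferentiableAt h2).congr_of_eventuallyEq ?_
    refine eventually_of_chart ?_
    filter_upwards [eventually_mem_coordDomain n E x₀] with z hz
    simp only [Function.comp_apply]
    rw [(chartAt ℂ x₀).right_inv hz.1, det_localMatrix _ hz]
  have := hM.apply_eq_of_compactSpace x y
  simpa only [neg_smul, one_smul, ← sub_eq_add_neg] using this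

end TotalSpaces

/-! ### Maximum principle: holomorphic maps between flat bundles are parallel. -/

section Metrics

open scoped Matrix.Norms.L2Operator ComplexOrder Topology

variable {X : Type*} [TopologicalSpace X] [ChartedSpace ℂ X] {n : ℕ}
  {E : X → Type*} [∀ x, TopologicalSpace (E x)] [∀ x, AddCommGroup (E x)] [∀ x, Module ℂ (E x)]
  [TopologicalSpace (TotalSpace (Fin n → ℂ) E)] [FiberBundle (Fin n → ℂ) E]
  [VectorBundle ℂ (Fin n → ℂ) E]
  {E' : X → Type*} [∀ x, TopologicalSpace (E' x)] [∀ x, AddCommGroup (E' x)]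
  [∀ x, Module ℂ (E' x)]
  [TopologicalSpace (TotalSpace (Fin n → ℂ) E')] [FiberBundle (Fin n → ℂ) E']
  [VectorBundle ℂ (Fin n → ℂ) E']

lemma symm_eq_sum_localFrame {x₀ : X} {z : ℂ} (hz : z ∈ coordDomain n E x₀) (v : Fin n → ℂ) :
    (trivializationAt (Fin n → ℂ) E x₀).symmₗ ℂ ((chartAt ℂ x₀).symm z) v =
      ∑ k, v k • localFrame n E x₀ k z := by
  conv_lhs => rw [pi_eq_sum_univ' v]
  simp only [map_sum, map_smul]
  refine Finset.sum_congr rfl fun k _ => ?_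
  rw [Trivialization.symmₗ_apply _ hz.2, localFrame]

lemma map_localFrame (φ : ∀ x, E x →ₗ[ℂ] E' x) {x₀ : X} {z : ℂ} (hz : z ∈ coordDomain n E x₀)
    (hz' : z ∈ coordDomain n E' x₀) (j : Fin n) :
    φ ((chartAt ℂ x₀).symm z) (localFrame n E x₀ j z) =
      ∑ k, localMatrix n φ x₀ z k j • localFrame n E' x₀ k z := by
  rw [← Trivialization.symmₗ_linearMapAt (R := ℂ) (trivializationAt (Fin n → ℂ) E' x₀) hz'.2
    (φ ((chartAt ℂ x₀).symm z) (localFrame n E x₀ j z)), symm_eq_sum_localFrame hz']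
  refine Finset.sum_congr rfl fun k _ => ?_
  rw [localMatrix_apply hz hz', Trivialization.linearMapAt_apply, if_pos hz'.2]

lemma gram_posDef (h : HermitianMetric n E) {x₀ : X} {z : ℂ} (hz : z ∈ coordDomain n E x₀) :
    (h.gram x₀ z).PosDef := by
  refine Matrix.PosDef.of_dotProduct_mulVec_pos ?_ fun v hv => ?_
  · ext i j
    exact h.conj_symm _ _ _
  · set u := (trivializationAt (Fin n → ℂ) E x₀).symmₗ ℂ ((chartAt ℂ x₀).symm z) v with hu
    have hu0 : u ≠ 0 := by
      intro h0
      apply hv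
      have := Trivialization.linearMapAt_symmₗ (R := ℂ) (trivializationAt (Fin n → ℂ) E x₀) hz.2 v
      rw [← this, ← hu, h0, map_zero]
    have h1 : star v ⬝ᵥ (h.gram x₀ z).mulVec v = h.form _ u u := by
      rw [hu, symm_eq_sum_localFrame hz]
      simp only [map_sum, LinearMap.sum_apply, map_smulₛₗ, LinearMap.smul_apply, smul_eq_mul,
        dotProduct, Matrix.mulVec, HermitianMetric.gram, Matrix.of_apply, Pi.star_apply,
        Finset.mul_sum, RingHom.id_apply]
      rw [Finset.sum_comm]
      refine Finset.sum_congr rfl fun i _ => Finset.sum_congr rfl fun j _ => ?_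
      rw [starRingEnd_apply]
      ring
    rw [h1, ← Complex.conj_eq_iff_re.1 (h.conj_symm _ u u)]
    exact_mod_cast h.pos _ u hu0

lemma exists_holomorphic_gram_factorization {h : HermitianMetric n E} (hflat : h.IsFlat)
    (x₀ : X) : ∃ G W : ℂ → Matrix (Fin n) (Fin n) ℂ, ∀ᶠ z in 𝓝 (chartAt ℂ x₀ x₀),
      DifferentiableAt ℂ G z ∧ DifferentiableAt ℂ W z ∧ G z * W z = 1 ∧ W z * G z = 1 ∧
        h.gram x₀ z = (G z).conjTranspose * G z :=
  exists_holomorphic_factorization (isOpen_coordDomain n E x₀) (h.smooth x₀)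
    (fun _ hz => gram_posDef h hz)
    (fun z hz i j => congrFun (congrFun (hflat x₀ z hz) i) j) (mem_coordDomain n E x₀)

lemma gram_mul_localMatrix {h : HermitianMetric n E} {h' : HermitianMetric n E'}
    {ψ : ∀ x, E x →ₗ[ℂ] E' x} {P : ∀ x, E x →ₗ[ℂ] E x}
    (hP : ∀ x v w, h.form x v (P x w) = h'.form x (ψ x v) (ψ x w)) {x₀ : X} {z : ℂ}
    (hz : z ∈ coordDomain n E x₀) (hz' : z ∈ coordDomain n E' x₀) :
    h.gram x₀ z * localMatrix n P x₀ z =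
      (localMatrix n ψ x₀ z).conjTranspose * h'.gram x₀ z * localMatrix n ψ x₀ z := by
  ext i j
  have h1 := hP _ (localFrame n E x₀ i z) (localFrame n E x₀ j z)
  rw [map_localFrame P hz hz, map_localFrame ψ hz hz', map_localFrame ψ hz hz'] at h1
  simp only [map_sum, LinearMap.sum_apply, map_smulₛₗ, LinearMap.smul_apply, smul_eq_mul,
    RingHom.id_apply] at h1
  simp only [Matrix.mul_apply, HermitianMetric.gram, Matrix.of_apply, Matrix.conjTranspose_apply,
    Finset.sum_mul]
  refine Eq.trans ?_ (h1.trans ?_)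
  · exact Finset.sum_congr rfl fun k _ => mul_comm _ _
  · refine Finset.sum_congr rfl fun k _ => ?_
    rw [Finset.mul_sum]
    refine Finset.sum_congr rfl fun l _ => ?_
    rw [starRingEnd_apply]
    ring

/-- The Euclidean norm is strictly convex, unlike the operator norm; this is what lets a maximum of
the norm force the function itself to be constant. -/
lemma re_trace_conjTranspose_mul_self (N : Matrix (Fin n) (Fin n) ℂ) :
    (N.conjTranspose * N).trace.re =
      ‖(WithLp.toLp 2 fun p : Fin n × Fin n => N p.1 p.2 : EuclideanSpace ℂ (Fin n × Fin n))‖ ^ 2 := by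
  rw [EuclideanSpace.norm_sq_eq, Fintype.sum_prod_type, Finset.sum_comm]
  simp only [Matrix.trace, Matrix.diag, Matrix.mul_apply, Matrix.conjTranspose_apply,
    Complex.re_sum]
  refine Finset.sum_congr rfl fun i _ => Finset.sum_congr rfl fun j _ => ?_
  rw [← starRingEnd_apply, ← Complex.normSq_eq_conj_mul_self, Complex.ofReal_re,
    Complex.normSq_eq_norm_sq]

/-- A holomorphic matrix valued function whose Hilbert-Schmidt norm has a local maximum is locally
constant. -/
lemma eventually_eq_of_isLocalMax_re_trace {N : ℂ → Matrix (Fin n) (Fin n) ℂ} {z₀ : ℂ}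
    (hN : ∀ᶠ z in 𝓝 z₀, DifferentiableAt ℂ N z)
    (hmax : ∀ᶠ z in 𝓝 z₀, ((N z).conjTranspose * N z).trace.re ≤
      ((N z₀).conjTranspose * N z₀).trace.re) :
    ∀ᶠ z in 𝓝 z₀, N z = N z₀ := by
  let F : ℂ → EuclideanSpace ℂ (Fin n × Fin n) := fun z =>
    WithLp.toLp 2 fun p : Fin n × Fin n => N z p.1 p.2
  have hF : ∀ᶠ z in 𝓝 z₀, DifferentiableAt ℂ F z := by
    filter_upwards [hN] with z hz
    refine differentiableAt_euclidean.2 fun p => ?_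
    exact differentiableAt_matrix_complex.1 hz p.1 p.2
  have hloc : IsLocalMax (norm ∘ F) z₀ := by
    filter_upwards [hmax] with z hz
    rw [re_trace_conjTranspose_mul_self, re_trace_conjTranspose_mul_self] at hz
    exact (sq_le_sq₀ (norm_nonneg _) (norm_nonneg _)).1 hz
  filter_upwards [Complex.eventually_eq_of_isLocalMax_norm hF hloc] with z hz
  ext i j
  exact congrArg (fun v : EuclideanSpace ℂ (Fin n × Fin n) => v (i, j)) hz

/-- In local unitary holomorphic frames, `ψ` is given by a holomorphic matrix `N`, and `ψ* ψ` is
conjugate to `Nᴴ N`. -/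
lemma exists_localMatrix_adjoint_comp_self {h : HermitianMetric n E} {h' : HermitianMetric n E'}
    (hflat : h.IsFlat) (hflat' : h'.IsFlat) {ψ : ∀ x, E x →ₗ[ℂ] E' x} {P : ∀ x, E x →ₗ[ℂ] E x}
    (hψ : ∀ x₀, ∀ᶠ z in 𝓝 (chartAt ℂ x₀ x₀), DifferentiableAt ℂ (localMatrix n ψ x₀) z)
    (hP : ∀ x v w, h.form x v (P x w) = h'.form x (ψ x v) (ψ x w)) (x₀ : X) :
    ∃ G W N : ℂ → Matrix (Fin n) (Fin n) ℂ, ∀ᶠ z in 𝓝 (chartAt ℂ x₀ x₀),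
      DifferentiableAt ℂ G z ∧ DifferentiableAt ℂ W z ∧ DifferentiableAt ℂ N z ∧ G z * W z = 1 ∧
        localMatrix n P x₀ z = W z * ((N z).conjTranspose * N z) * G z := by
  obtain ⟨G, W, hG⟩ := exists_holomorphic_gram_factorization hflat x₀
  obtain ⟨G', W', hG'⟩ := exists_holomorphic_gram_factorization hflat' x₀
  refine ⟨G, W, fun z => G' z * localMatrix n ψ x₀ z * W z, ?_⟩
  filter_upwards [hG, hG', hψ x₀, eventually_mem_coordDomain n E x₀,
    eventually_mem_coordDomain n E' x₀] with z hz hz' hd hE hE'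
  obtain ⟨h1, h2, h3, h4, h5⟩ := hz
  obtain ⟨h1', -, -, -, h5'⟩ := hz'
  refine ⟨h1, h2, (h1'.mul hd).mul h2, h3, ?_⟩
  have key := gram_mul_localMatrix hP hE hE'
  rw [h5, h5'] at key
  have h6 : (W z).conjTranspose * (G z).conjTranspose = 1 := by
    rw [← Matrix.conjTranspose_mul, h3, Matrix.conjTranspose_one]
  -- Since `H = Gᴴ G` has inverse `W Wᴴ`, the relation `H P = ψᴴ H' ψ` can be solved for `P`.
  calc localMatrix n P x₀ z
      = (W z * ((W z).conjTranspose * (G z).conjTranspose) * G z) * localMatrix n P x₀ z := by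
        rw [h6, mul_one, h4, one_mul]
    _ = W z * (W z).conjTranspose * ((G z).conjTranspose * G z * localMatrix n P x₀ z) *
          (W z * G z) := by
        rw [h4, mul_one]
        simp only [mul_assoc]
    _ = _ := by
        rw [key]
        simp only [Matrix.conjTranspose_mul, mul_assoc]

/-- A holomorphic map `ψ` between flat hermitian bundles on a compact Riemann surface is
parallel; in particular `ψ* ψ` is holomorphic. -/
theorem isHolomorphicFamily_adjoint_comp_self [CompactSpace X] [ConnectedSpace X]
    {h : HermitianMetric n E} {h' : HermitianMetric n E'}
    (hflat : h.IsFlat) (hflat' : h'.IsFlat) {ψ : ∀ x, E x →ₗ[ℂ] E' x} {P : ∀ x, E x →ₗ[ℂ] E x}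
    (hψ : ∀ x₀, ∀ᶠ z in 𝓝 (chartAt ℂ x₀ x₀), DifferentiableAt ℂ (localMatrix n ψ x₀) z)
    (hP : ∀ x v w, h.form x v (P x w) = h'.form x (ψ x v) (ψ x w)) :
    IsHolomorphicFamily n P := by
  choose G W N hN using exists_localMatrix_adjoint_comp_self hflat hflat' hψ hP
  -- The frames are only local, but `‖N‖² = tr P` does not depend on them and lives on all of `X`.
  let f : X → ℝ := fun x => (LinearMap.trace ℂ (E x) (P x)).re
  have hf : ∀ x₀, ∀ᶠ z in 𝓝 (chartAt ℂ x₀ x₀), f ((chartAt ℂ x₀).symm z) =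
      ((N x₀ z).conjTranspose * N x₀ z).trace.re := by
    intro x₀
    filter_upwards [hN x₀, eventually_mem_coordDomain n E x₀] with z hz hE
    obtain ⟨-, -, -, h1, h2⟩ := hz
    change (LinearMap.trace ℂ _ (P ((chartAt ℂ x₀).symm z))).re = _
    rw [← trace_localMatrix P hE, h2, Matrix.trace_mul_comm, ← mul_assoc, h1, one_mul]
  have hf₀ : ∀ x₀, f x₀ = ((N x₀ (chartAt ℂ x₀ x₀)).conjTranspose *
      N x₀ (chartAt ℂ x₀ x₀)).trace.re := by
    intro x₀
    rw [← (hf x₀).self_of_nhds, (chartAt ℂ x₀).left_inv (mem_chart_source ℂ x₀)]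
  have hfc : Continuous f := by
    refine continuous_iff_continuousAt.2 fun x₀ => ?_
    have h1 : ContinuousAt (fun z => ((N x₀ z).conjTranspose * N x₀ z).trace.re)
        (chartAt ℂ x₀ x₀) := by
      have h2 : ContinuousAt (N x₀) (chartAt ℂ x₀ x₀) :=
        (hN x₀).self_of_nhds.2.2.1.continuousAt
      fun_prop
    have h3 := ContinuousAt.comp (f := chartAt ℂ x₀) h1
      ((chartAt ℂ x₀).continuousAt (mem_chart_source ℂ x₀))
    refine h3.congr ?_
    refine eventually_of_chart ?_
    filter_upwards [hf x₀, eventually_mem_coordDomain n E x₀] with z hz hE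
    rw [Function.comp_apply, (chartAt ℂ x₀).right_inv hE.1, hz]
  obtain ⟨x₁, -, hx₁⟩ := isCompact_univ.exists_isMaxOn Set.univ_nonempty hfc.continuousOn
  have hloc : ∀ x₀, f x₀ = f x₁ →
      ∀ᶠ z in 𝓝 (chartAt ℂ x₀ x₀), N x₀ z = N x₀ (chartAt ℂ x₀ x₀) := by
    intro x₀ hx₀
    refine eventually_eq_of_isLocalMax_re_trace ((hN x₀).mono fun z hz => hz.2.2.1) ?_
    filter_upwards [hf x₀] with z hz
    rw [← hz, ← hf₀, hx₀]
    exact hx₁ (Set.mem_univ _)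
  -- The set where the maximum is attained is closed by continuity and open by the maximum
  -- principle.
  have hconst : {x | f x = f x₁} = Set.univ := by
    refine IsClopen.eq_univ ⟨isClosed_eq hfc continuous_const, ?_⟩ ⟨x₁, rfl⟩
    refine isOpen_iff_mem_nhds.2 fun x₀ hx₀ => ?_
    refine eventually_of_chart (p := fun x => f x = f x₁) ?_
    filter_upwards [hloc x₀ hx₀, hf x₀] with z hz hz'
    rw [hz', hz, ← hf₀]
    exact hx₀
  intro x₀
  have hx₀ : f x₀ = f x₁ := Set.eq_univ_iff_forall.1 hconst x₀
  -- Near `x₀`, `P = W C G` with `C = Nᴴ N` constant, and `W`, `G` are holomorphic.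
  obtain ⟨hG, hW, -⟩ := (hN x₀).self_of_nhds
  refine ((hW.mul_const ((N x₀ (chartAt ℂ x₀ x₀)).conjTranspose *
    N x₀ (chartAt ℂ x₀ x₀))).mul hG).congr_of_eventuallyEq ?_
  filter_upwards [hN x₀, hloc x₀ hx₀] with z hz hz'
  rw [hz.2.2.2.2, hz']
  rfl

end Metrics

/-! ### Complex linearity of real differentials. -/

section Antilinear

variable {V V' : Type*} [NormedAddCommGroup V] [NormedSpace ℂ V] [NormedAddCommGroup V']
  [NormedSpace ℂ V']

lemma smul_eq_re_smul_add_im_smul (c : ℂ) (v : V) :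
    c • v = c.re • v + c.im • Complex.I • v := by
  conv_lhs => rw [← Complex.re_add_im c, add_smul, mul_smul]
  simp

/-- A real linear map commuting with multiplication by `i` is complex linear. -/
noncomputable def complexLinearOfReal (L : V →L[ℝ] V') (hL : ∀ v, L (Complex.I • v) = Complex.I • L v) :
    V →L[ℂ] V' where
  toFun := L
  map_add' := map_add L
  map_smul' c v := by
    rw [RingHom.id_apply, smul_eq_re_smul_add_im_smul c v, smul_eq_re_smul_add_im_smul c (L v),
      map_add, map_smul, map_smul, hL]
  cont := L.cont

end Antilinear

/-! ### Conjugation of holomorphic maps by real or quaternionic structures. -/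

section RealStructures

variable {X : Type*} [TopologicalSpace X] [ChartedSpace ℂ X] {n : ℕ}
  {E : X → Type*} [∀ x, TopologicalSpace (E x)] [∀ x, AddCommGroup (E x)] [∀ x, Module ℂ (E x)]
  [TopologicalSpace (TotalSpace (Fin n → ℂ) E)] [FiberBundle (Fin n → ℂ) E]
  {E' : X → Type*} [∀ x, TopologicalSpace (E' x)] [∀ x, AddCommGroup (E' x)]
  [∀ x, Module ℂ (E' x)]
  [TopologicalSpace (TotalSpace (Fin n → ℂ) E')] [FiberBundle (Fin n → ℂ) E']
  {σ : X → X}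

/-- The charts are the same over `ℝ` and over `ℂ`, so the definition is literally a real manifold
derivative, to which the chain rule applies. -/
lemma Lift.exists_hasMFDerivAt (s : Lift n E σ) (p : TotalSpace (Fin n → ℂ) E) :
    ∃ L : ℂ × (Fin n → ℂ) →L[ℝ] ℂ × (Fin n → ℂ),
      (∀ v, L (Complex.I • v) = -(Complex.I • L v)) ∧
      HasMFDerivAt (𝓘(ℝ, ℂ).prod 𝓘(ℝ, Fin n → ℂ)) (𝓘(ℝ, ℂ).prod 𝓘(ℝ, Fin n → ℂ))
        s.totalMap p L := by
  obtain ⟨hc, hd⟩ := s.antiholomorphic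
  obtain ⟨L, hL, hd⟩ := hd p
  exact ⟨L, hL, hc.continuousAt, hd⟩

lemma exists_hasMFDerivAt_of_mdifferentiable
    {f : TotalSpace (Fin n → ℂ) E → TotalSpace (Fin n → ℂ) E'}
    (hf : MDifferentiable (𝓘(ℂ, ℂ).prod 𝓘(ℂ, Fin n → ℂ)) (𝓘(ℂ, ℂ).prod 𝓘(ℂ, Fin n → ℂ)) f)
    (p : TotalSpace (Fin n → ℂ) E) :
    ∃ L : ℂ × (Fin n → ℂ) →L[ℝ] ℂ × (Fin n → ℂ),
      (∀ v, L (Complex.I • v) = Complex.I • L v) ∧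
      HasMFDerivAt (𝓘(ℝ, ℂ).prod 𝓘(ℝ, Fin n → ℂ)) (𝓘(ℝ, ℂ).prod 𝓘(ℝ, Fin n → ℂ)) f p L := by
  obtain ⟨hc, hd⟩ := (hf p).hasMFDerivAt
  let D : ℂ × (Fin n → ℂ) →L[ℂ] ℂ × (Fin n → ℂ) := mfderiv (𝓘(ℂ, ℂ).prod 𝓘(ℂ, Fin n → ℂ))
    (𝓘(ℂ, ℂ).prod 𝓘(ℂ, Fin n → ℂ)) f p
  refine ⟨D.restrictScalars ℝ, fun v => D.map_smul Complex.I v, hc, ?_⟩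
  exact HasFDerivWithinAt.restrictScalars ℝ (f' := D) hd

lemma mdifferentiableAt_of_hasMFDerivAt
    {f : TotalSpace (Fin n → ℂ) E → TotalSpace (Fin n → ℂ) E'} {p : TotalSpace (Fin n → ℂ) E}
    {L : ℂ × (Fin n → ℂ) →L[ℝ] ℂ × (Fin n → ℂ)} (hL : ∀ v, L (Complex.I • v) = Complex.I • L v)
    (hf : HasMFDerivAt (𝓘(ℝ, ℂ).prod 𝓘(ℝ, Fin n → ℂ)) (𝓘(ℝ, ℂ).prod 𝓘(ℝ, Fin n → ℂ)) f p L) :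
    MDifferentiableAt (𝓘(ℂ, ℂ).prod 𝓘(ℂ, Fin n → ℂ)) (𝓘(ℂ, ℂ).prod 𝓘(ℂ, Fin n → ℂ)) f p := by
  have h : HasMFDerivAt (𝓘(ℂ, ℂ).prod 𝓘(ℂ, Fin n → ℂ)) (𝓘(ℂ, ℂ).prod 𝓘(ℂ, Fin n → ℂ)) f p
      (complexLinearOfReal L hL) :=
    ⟨hf.1, HasFDerivWithinAt.of_restrictScalars ℝ (f' := complexLinearOfReal L hL) hf.2 rfl⟩
  exact h.mdifferentiableAt

lemma Lift.totalMap_injective (s : Lift n E σ) (hs : s.IsReal ∨ s.IsQuaternionic) :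
    Function.Injective s.totalMap := by
  intro p q hpq
  have h := congrArg s.totalMap hpq
  rcases hs with hs | hs
  · rwa [hs, hs] at h
  · rw [hs, hs] at h
    obtain ⟨x, v⟩ := p
    obtain ⟨y, w⟩ := q
    obtain rfl : x = y := congrArg TotalSpace.proj h
    simpa [TotalSpace.mk_inj] using h

/-- The square is `1` or `-1`; in both cases the cube is an inverse, which is therefore
antiholomorphic at no extra cost. -/
lemma Lift.totalMap_iterate_four (s : Lift n E σ) (hs : s.IsReal ∨ s.IsQuaternionic)
    (p : TotalSpace (Fin n → ℂ) E) :
    s.totalMap (s.totalMap (s.totalMap (s.totalMap p))) = p := by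
  rcases hs with hs | hs
  · rw [hs, hs]
  · rw [hs, hs]
    simp

lemma Lift.bijective (s : Lift n E σ) (hs : s.IsReal ∨ s.IsQuaternionic)
    (hσ : Function.Injective σ) (x : X) : Function.Bijective (s.toFun x) := by
  constructor
  · intro v w hvw
    have h : s.totalMap ⟨x, v⟩ = s.totalMap ⟨x, w⟩ := by simp only [Lift.totalMap, hvw]
    exact TotalSpace.mk_inj.1 (s.totalMap_injective hs h)
  · intro w
    have h := s.totalMap_iterate_four hs ⟨σ x, w⟩
    -- The candidate preimage, the cube applied to `w`, lies over a point `y` with `σ y = σ x`;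
    -- injectivity of `σ` places it over `x`.
    generalize s.totalMap (s.totalMap (s.totalMap ⟨σ x, w⟩)) = q at h
    obtain ⟨y, v⟩ := q
    obtain rfl : y = x := hσ (congrArg TotalSpace.proj h)
    exact ⟨v, TotalSpace.mk_inj.1 h⟩

/-- The conjugate `σ'⁻¹ ∘ φ ∘ σ` of a family of linear maps by two antilinear lifts of `σ`. -/
noncomputable def conjFamily (s : Lift n E σ) (s' : Lift n E' σ)
    (hb' : ∀ x, Function.Bijective (s'.toFun x)) (φ : ∀ x, E x →ₗ[ℂ] E' x) (x : X) :
    E x →ₗ[ℂ] E' x :=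
  ((LinearEquiv.ofBijective (s'.toFun x) (hb' x)).symm.toLinearMap ∘ₛₗ φ (σ x)) ∘ₛₗ s.toFun x

lemma toFun_conjFamily (s : Lift n E σ) (s' : Lift n E' σ)
    (hb' : ∀ x, Function.Bijective (s'.toFun x)) (φ : ∀ x, E x →ₗ[ℂ] E' x) (x : X) (v : E x) :
    s'.toFun x (conjFamily s s' hb' φ x v) = φ (σ x) (s.toFun x v) :=
  (LinearEquiv.ofBijective (s'.toFun x) (hb' x)).apply_symm_apply _

lemma totalFamily_conjFamily (s : Lift n E σ) (s' : Lift n E' σ)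
    (hs' : s'.IsReal ∨ s'.IsQuaternionic)
    (hb' : ∀ x, Function.Bijective (s'.toFun x)) (φ : ∀ x, E x →ₗ[ℂ] E' x) :
    totalFamily n (conjFamily s s' hb' φ) =
      s'.totalMap ∘ s'.totalMap ∘ s'.totalMap ∘ totalFamily n φ ∘ s.totalMap := by
  funext p
  refine (s'.totalMap_iterate_four hs' _).symm.trans ?_
  simp only [Function.comp_apply]
  congr 3
  exact congrArg (TotalSpace.mk _) (toFun_conjFamily s s' hb' φ p.1 p.2)

lemma mdifferentiable_conjFamily (s : Lift n E σ) (s' : Lift n E' σ)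
    (hs' : s'.IsReal ∨ s'.IsQuaternionic)
    (hb' : ∀ x, Function.Bijective (s'.toFun x)) {φ : ∀ x, E x →ₗ[ℂ] E' x}
    (hφ : MDifferentiable (𝓘(ℂ, ℂ).prod 𝓘(ℂ, Fin n → ℂ)) (𝓘(ℂ, ℂ).prod 𝓘(ℂ, Fin n → ℂ))
      (totalFamily n φ)) :
    MDifferentiable (𝓘(ℂ, ℂ).prod 𝓘(ℂ, Fin n → ℂ)) (𝓘(ℂ, ℂ).prod 𝓘(ℂ, Fin n → ℂ))
      (totalFamily n (conjFamily s s' hb' φ)) := by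
  intro p
  rw [totalFamily_conjFamily s s' hs']
  obtain ⟨L₁, a₁, h₁⟩ := s.exists_hasMFDerivAt p
  obtain ⟨L₂, a₂, h₂⟩ := exists_hasMFDerivAt_of_mdifferentiable hφ (s.totalMap p)
  obtain ⟨L₃, a₃, h₃⟩ := s'.exists_hasMFDerivAt (totalFamily n φ (s.totalMap p))
  obtain ⟨L₄, a₄, h₄⟩ := s'.exists_hasMFDerivAt (s'.totalMap (totalFamily n φ (s.totalMap p)))
  obtain ⟨L₅, a₅, h₅⟩ := s'.exists_hasMFDerivAt
    (s'.totalMap (s'.totalMap (totalFamily n φ (s.totalMap p))))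
  have h := h₅.comp p (h₄.comp p (h₃.comp p (h₂.comp p h₁)))
  -- Four of the five differentials are antilinear and one is linear, so the composite is complex
  -- linear.
  refine mdifferentiableAt_of_hasMFDerivAt (L := L₅ ∘L L₄ ∘L L₃ ∘L L₂ ∘L L₁) (fun v => ?_) h
  simp [a₁, a₂, a₃, a₄, a₅]

end RealStructures

/-! ### Making the isomorphism equivariant. -/

lemma det_smul_sub_eq_zero_iff {V : Type*} [AddCommGroup V] [Module ℂ V] [FiniteDimensional ℂ V]
    (P : V →ₗ[ℂ] V) (μ : ℂ) :
    LinearMap.det (μ • LinearMap.id - P) = 0 ↔ Module.End.HasEigenvalue P μ := by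
  rw [Module.End.hasEigenvalue_iff_mem_spectrum, spectrum.mem_iff,
    Algebra.algebraMap_eq_smul_one, LinearMap.isUnit_iff_isUnit_det, isUnit_iff_ne_zero, not_not]
  rfl

/-- The unit circle contains a number whose negative square avoids a given finite set. -/
lemma exists_norm_eq_one_neg_sq_notMem {S : Set ℂ} (hS : S.Finite) :
    ∃ a : ℂ, starRingEnd ℂ a * a = 1 ∧ -a ^ 2 ∉ S := by
  have hinf : (Metric.sphere (0 : ℂ) 1).Infinite := by
    refine (isPreconnected_sphere (by simp) 0 1).infinite_of_nontrivial
      ⟨1, by simp, -1, by simp, by norm_num⟩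
  obtain ⟨μ, hμ, hμS⟩ := (hinf.sdiff hS).nonempty
  -- `μ` lies on the unit circle outside `S`, and `a` is chosen so that `-a² = μ`.
  obtain ⟨a, ha⟩ := IsAlgClosed.exists_pow_nat_eq (-μ) (n := 2) two_pos
  refine ⟨a, ?_, by rwa [ha, neg_neg]⟩
  have h1 : ‖a‖ ^ 2 = 1 := by
    rw [← norm_pow, ha, norm_neg]
    simpa using hμ
  rw [← Complex.normSq_eq_conj_mul_self, Complex.normSq_eq_norm_sq, h1, Complex.ofReal_one]

section

variable {X : Type*} [TopologicalSpace X] [ChartedSpace ℂ X] {n : ℕ}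
  {E : X → Type*} [∀ x, TopologicalSpace (E x)] [∀ x, AddCommGroup (E x)] [∀ x, Module ℂ (E x)]
  [TopologicalSpace (TotalSpace (Fin n → ℂ) E)] [FiberBundle (Fin n → ℂ) E]
  {E' : X → Type*} [∀ x, TopologicalSpace (E' x)] [∀ x, AddCommGroup (E' x)]
  [∀ x, Module ℂ (E' x)]
  [TopologicalSpace (TotalSpace (Fin n → ℂ) E')] [FiberBundle (Fin n → ℂ) E']
  {σ : X → X}

variable (n E) in
lemma finiteDimensional_fiber [VectorBundle ℂ (Fin n → ℂ) E] (x : X) :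
    FiniteDimensional ℂ (E x) :=
  ((trivializationAt (Fin n → ℂ) E x).linearEquivAt ℂ x
    (FiberBundle.mem_baseSet_trivializationAt' x)).symm.finiteDimensional

lemma HermitianMetric.ext_left (h : HermitianMetric n E) {x : X} {v w : E x}
    (hvw : ∀ u, h.form x u v = h.form x u w) : v = w := by
  by_contra hne
  have h1 := h.pos x (v - w) (sub_ne_zero.2 hne)
  rw [map_sub, hvw, sub_self] at h1
  simp at h1

/-- After applying `s'` this is `φ s² = s'² φ`, which holds because both squares are the same sign.
-/
lemma conjFamily_toFun (s : Lift n E σ) (s' : Lift n E' σ)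
    (hss' : (s.IsReal ∧ s'.IsReal) ∨ (s.IsQuaternionic ∧ s'.IsQuaternionic))
    (hb' : ∀ x, Function.Bijective (s'.toFun x)) (φ : ∀ x, E x →ₗ[ℂ] E' x) (x : X) (v : E x) :
    conjFamily s s' hb' φ (σ x) (s.toFun x v) = s'.toFun x (φ x v) := by
  refine (hb' (σ x)).1 ?_
  rw [toFun_conjFamily]
  have h : totalFamily n φ (s.totalMap (s.totalMap ⟨x, v⟩)) =
      s'.totalMap (s'.totalMap (totalFamily n φ ⟨x, v⟩)) := by
    rcases hss' with ⟨h, h'⟩ | ⟨h, h'⟩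
    · rw [h, h']
    · rw [h, h']
      simp [totalFamily]
      rfl
  exact TotalSpace.mk_inj.1 h

/-- Two isomorphic bundles with real or quaternionic structures are isomorphic by an isomorphism
which is compatible with these structures. -/
theorem exists_equivariant_family [CompactSpace X] [ConnectedSpace X] [IsManifold 𝓘(ℂ, ℂ) ω X]
    [VectorBundle ℂ (Fin n → ℂ) E] [ContMDiffVectorBundle ω (Fin n → ℂ) E 𝓘(ℂ, ℂ)]
    [VectorBundle ℂ (Fin n → ℂ) E'] [ContMDiffVectorBundle ω (Fin n → ℂ) E' 𝓘(ℂ, ℂ)]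
    (hσ : Function.Injective σ) (s : Lift n E σ) (s' : Lift n E' σ)
    (hss' : (s.IsReal ∧ s'.IsReal) ∨ (s.IsQuaternionic ∧ s'.IsQuaternionic))
    (f : HolomorphicIso n E E') :
    ∃ ψ : ∀ x, E x ≃ₗ[ℂ] E' x, (IsHolomorphicFamily n fun x => (ψ x).toLinearMap) ∧
      ∀ x v, ψ (σ x) (s.toFun x v) = s'.toFun x (ψ x v) := by
  have hfin := finiteDimensional_fiber n E
  have hs' : s'.IsReal ∨ s'.IsQuaternionic := hss'.imp And.right And.right
  have hb' := s'.bijective hs' hσ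
  set φ : ∀ x, E x →ₗ[ℂ] E' x := fun x => (f.toEquiv x).toLinearMap with hφdef
  have hφ : IsHolomorphicFamily n φ := isHolomorphicFamily_of_mdifferentiable f.holomorphic
  set φ' := conjFamily s s' hb' φ
  have hφ' : IsHolomorphicFamily n φ' := isHolomorphicFamily_of_mdifferentiable
    (mdifferentiable_conjFamily s s' hs' hb' f.holomorphic)
  have hQ : IsHolomorphicFamily n fun x => (f.toEquiv x).symm.toLinearMap ∘ₗ φ' x :=
    hφ.symm.comp hφ'
  set Q : ∀ x, E x →ₗ[ℂ] E x := fun x => (f.toEquiv x).symm.toLinearMap ∘ₗ φ' x with hQdef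
  obtain ⟨x₁⟩ := (inferInstance : Nonempty X)
  obtain ⟨a, ha, haS⟩ := exists_norm_eq_one_neg_sq_notMem (Module.End.finite_hasEigenvalue (Q x₁))
  have hdet : ∀ x, LinearMap.det ((-a ^ 2) • LinearMap.id - Q x) ≠ 0 := by
    intro x hx
    rw [det_smul_sub_eq hQ (-a ^ 2) x x₁, det_smul_sub_eq_zero_iff] at hx
    exact haS hx
  have ha0 : -starRingEnd ℂ a ≠ 0 := neg_ne_zero.2 (left_ne_zero_of_mul_eq_one ha)
  -- As `ā a² = a`, the sum `a φ + ā φ'` equals `φ ∘ (-ā) (-a² - Q)`, visibly invertible.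
  let ψ : ∀ x, E x ≃ₗ[ℂ] E' x := fun x =>
    ((LinearMap.equivOfDetNeZero _ (hdet x)).trans
      (LinearEquiv.smulOfNeZero ℂ (E x) _ ha0)).trans (f.toEquiv x)
  have hψ : ∀ x, (ψ x).toLinearMap = a • φ x + starRingEnd ℂ a • φ' x := by
    intro x
    ext v
    have h1 : ψ x v = f.toEquiv x ((-starRingEnd ℂ a) •
        ((-a ^ 2) • v - (f.toEquiv x).symm (φ' x v))) := rfl
    rw [LinearEquiv.coe_coe, h1, map_smul, map_sub, map_smul, LinearEquiv.apply_symm_apply,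
      smul_sub, smul_smul]
    have h2 : -starRingEnd ℂ a * -a ^ 2 = a := by linear_combination a * ha
    rw [h2, neg_smul, sub_neg_eq_add]
    rfl
  refine ⟨ψ, ?_, fun x v => ?_⟩
  · simp only [hψ]
    exact (hφ.const_smul a).add (hφ'.const_smul _)
  · have h1 : ∀ x v, ψ x v = a • φ x v + starRingEnd ℂ a • φ' x v := fun x v =>
      LinearMap.congr_fun (hψ x) v
    -- The structures exchange `φ` and `φ'`, while antilinearity exchanges `a` and `ā`.
    rw [h1, h1, map_add, map_smulₛₗ, map_smulₛₗ, Complex.conj_conj, toFun_conjFamily,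
      conjFamily_toFun s s' hss', add_comm]

end

end RealCurve

/-! ### Polar decomposition of the equivariant isomorphism. -/

theorem mainTheorem10
    {X : Type*} [TopologicalSpace X] [T2Space X] [CompactSpace X] [ConnectedSpace X]
    [ChartedSpace ℂ X] [IsManifold 𝓘(ℂ, ℂ) ω X]
    (σ : X → X) (hσ : RealCurve.IsAntiholomorphicInvolution σ)
    (n : ℕ)
    (E : X → Type*) [∀ x, TopologicalSpace (E x)] [∀ x, AddCommGroup (E x)]
    [∀ x, Module ℂ (E x)]
    [TopologicalSpace (TotalSpace (Fin n → ℂ) E)] [FiberBundle (Fin n → ℂ) E]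
    [VectorBundle ℂ (Fin n → ℂ) E] [ContMDiffVectorBundle ω (Fin n → ℂ) E 𝓘(ℂ, ℂ)]
    (E' : X → Type*) [∀ x, TopologicalSpace (E' x)] [∀ x, AddCommGroup (E' x)]
    [∀ x, Module ℂ (E' x)]
    [TopologicalSpace (TotalSpace (Fin n → ℂ) E')] [FiberBundle (Fin n → ℂ) E']
    [VectorBundle ℂ (Fin n → ℂ) E'] [ContMDiffVectorBundle ω (Fin n → ℂ) E' 𝓘(ℂ, ℂ)]
    (h : RealCurve.HermitianMetric n E) (h' : RealCurve.HermitianMetric n E')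
    (hflat : h.IsFlat) (hflat' : h'.IsFlat)
    (s : RealCurve.Lift n E σ) (s' : RealCurve.Lift n E' σ)
    (hss' : (s.IsReal ∧ s'.IsReal) ∨ (s.IsQuaternionic ∧ s'.IsQuaternionic))
    (hs : s.IsUnitary h) (hs' : s'.IsUnitary h')
    (hiso : Nonempty (RealCurve.HolomorphicIso n E E')) :
    ∃ f : RealCurve.HolomorphicIso n E E',
      (∀ (x : X) (v w : E x),
        h'.form x (f.toEquiv x v) (f.toEquiv x w) = h.form x v w) ∧
      (∀ (x : X) (v : E x),
        f.toEquiv (σ x) (s.toFun x v) = s'.toFun x (f.toEquiv x v)) := by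
  have hfin := RealCurve.finiteDimensional_fiber n E
  have hfin' := RealCurve.finiteDimensional_fiber n E'
  have hb := s.bijective (hss'.imp And.left And.left) hσ.involutive.injective
  obtain ⟨f₀⟩ := hiso
  obtain ⟨ψ, hψ, hψs⟩ :=
    RealCurve.exists_equivariant_family hσ.involutive.injective s s' hss' f₀
  choose P hP using fun x => RealCurve.exists_adjoint_comp_self (h.form x) (h.conj_symm x) (h.pos x)
    (h'.form x) (h'.conj_symm x) (h'.pos x) (ψ x).toLinearMap
  have hPsymm : ∀ x v w, h.form x (P x v) w = h.form x v (P x w) := by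
    intro x v w
    rw [← h.conj_symm, hP, hP, h'.conj_symm]
  have hψd : ∀ x₀, ∀ᶠ z in nhds (chartAt ℂ x₀ x₀), DifferentiableAt ℂ
      (RealCurve.localMatrix n (fun x => (ψ x).toLinearMap) x₀) z := by
    intro x₀
    filter_upwards [RealCurve.eventually_mem_coordDomain n E x₀,
      RealCurve.eventually_mem_coordDomain n E' x₀] with z hz hz'
    exact RealCurve.differentiableAt_localMatrix hψ.mdifferentiable hz hz'
  have hPhol : RealCurve.IsHolomorphicFamily n P :=
    RealCurve.isHolomorphicFamily_adjoint_comp_self hflat hflat' hψd hP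
  obtain ⟨x₁⟩ := (inferInstance : Nonempty X)
  -- Constancy of the spectrum allows one polynomial, chosen at `x₁`, to serve in every fibre;
  -- fibrewise choices would lose holomorphy.
  have heig : ∀ x μ, Module.End.HasEigenvalue (P x) μ → Module.End.HasEigenvalue (P x₁) μ := by
    intro x μ hμ
    rwa [← RealCurve.det_smul_sub_eq_zero_iff, RealCurve.det_smul_sub_eq hPhol μ x₁ x,
      RealCurve.det_smul_sub_eq_zero_iff]
  have hpos : ∀ μ, Module.End.HasEigenvalue (P x₁) μ → 0 < μ.re ∧ (μ.re : ℂ) = μ := fun μ hμ =>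
    RealCurve.eigenvalue_pos (h.form x₁) (h.conj_symm x₁) (h.pos x₁) (h'.form x₁)
      (h'.conj_symm x₁) (h'.pos x₁) (ψ x₁) (hP x₁) hμ
  obtain ⟨q, hq⟩ := RealCurve.exists_polynomial_inv_sqrt
    ((Module.End.finite_hasEigenvalue (P x₁)).toFinset.image Complex.re) (by
      intro t ht
      obtain ⟨μ, hμ, rfl⟩ := Finset.mem_image.1 ht
      exact (hpos μ ((Set.Finite.mem_toFinset _).1 hμ)).1)
  set qc := q.map (algebraMap ℝ ℂ) with hqc
  have hqP : ∀ x v, Polynomial.aeval (P x) qc (P x (Polynomial.aeval (P x) qc v)) = v := by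
    intro x v
    have h1 := RealCurve.aeval_eq_zero_of_symmetric (h.form x) (h.conj_symm x) (h.pos x) (P x)
      (hPsymm x) (qc * (Polynomial.X * qc) - 1) (by
        intro μ hμ
        have h2 := heig x μ hμ
        have h3 := hq μ.re (Finset.mem_image_of_mem _ ((Set.Finite.mem_toFinset _).2 h2))
        have h4 : qc.eval μ = ((q.eval μ.re : ℝ) : ℂ) := by
          rw [hqc, ← (hpos μ h2).2]
          exact Polynomial.eval_map_apply (algebraMap ℝ ℂ) μ.re
        rw [Polynomial.eval_sub, Polynomial.eval_mul, Polynomial.eval_mul, Polynomial.eval_X,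
          Polynomial.eval_one, h4, sub_eq_zero]
        conv_lhs => rw [← (hpos μ h2).2]
        exact_mod_cast h3)
    rw [map_sub, map_mul, map_mul, Polynomial.aeval_X, map_one, sub_eq_zero] at h1
    exact LinearMap.congr_fun h1 v
  have hA : ∀ x, Function.Bijective (Polynomial.aeval (P x) qc) := fun x =>
    ⟨Function.LeftInverse.injective (g := fun v => Polynomial.aeval (P x) qc (P x v)) (hqP x),
      fun v => ⟨_, hqP x v⟩⟩
  let u : ∀ x, E x ≃ₗ[ℂ] E' x := fun x => (LinearEquiv.ofBijective _ (hA x)).trans (ψ x)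
  have hu : RealCurve.IsHolomorphicFamily n fun x => (u x).toLinearMap :=
    hψ.comp (hPhol.aeval qc)
  -- `ψ` is equivariant and both structures are antiunitary, so `ψ* ψ` commutes with `s`; testing
  -- against vectors `s w` is enough because `s` is onto each fibre.
  have hPs : ∀ x v, s.toFun x (P x v) = P (σ x) (s.toFun x v) := by
    intro x v
    refine h.ext_left fun y => ?_
    obtain ⟨w, rfl⟩ := (hb x).2 y
    rw [hs, hP, hP]
    simp only [LinearEquiv.coe_coe]
    rw [hψs, hψs, hs']
  refine ⟨⟨u, hu.mdifferentiable, hu.symm.mdifferentiable⟩, fun x v w => ?_, fun x v => ?_⟩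
  · change h'.form x (ψ x (Polynomial.aeval (P x) qc v)) (ψ x (Polynomial.aeval (P x) qc w)) = _
    refine (hP x _ _).symm.trans ?_
    rw [RealCurve.aeval_symmetric (h.form x) (hPsymm x), hqP]
  · change ψ (σ x) (Polynomial.aeval (P (σ x)) qc (s.toFun x v)) =
      s'.toFun x (ψ x (Polynomial.aeval (P x) qc v))
    rw [← RealCurve.aeval_semiconj (s.toFun x) (hPs x), hψs]
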